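/- **Setting.** A community of $N$ users is described by a directed graph, where an edge $(i,j)$ means that $i$ trusts $j$; write $N(i)$ for the set of users trusted by $i$. A set $N_R$ of users are raters; every rater gives the rating $r\in(0,1]$, and every edge carries the same trust value $t\in(0,1]$. For a weight parameter $\alpha\in[\tfrac12,1)$ put $a_j=\alpha$ if $j\in N_R$ and $a_j=1-\alpha$ otherwise. The satisfaction scores $(s_i)$ are the unique solution of: $s_i=r$ for $i\in N_R$; $s_i=\dfrac{\sum_{j\in N(i)}a_j t^2 s_j}{\sum_{j\in N(i)}a_j t}$ for a non-rater $i$ with $N(i)\neq\emptyset$; $s_i=0$ if $i$ does not trust any rater, even indirectly. All users have the same threshold $b\in(0,1)$ with $b<r$, and $i$ is satisfied if $s_i>b$. Let $\lambda>0$. The graph is a directed Erdős–Rényi graph: each of the $N(N-1)$ possible edges is present independently with probability $\min(\lambda/N,1)$. The raters form, independently of the graph, a uniformly distributed set of $m_N\le N$ users, where $m_N/N\to k$ as $N\to\infty$; $k$ is the proportion of raters. Let $P_N^{\alpha}$ be the expected proportion of satisfied users among the non-raters (with value $1$ if there are no non-raters), and $C_N^{\alpha}$ the expected proportion of satisfied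 users in the whole community. Define $$k^{\min}(T)=\frac{bT\,(1-t(1-e^{-\lambda}))}{t(1-e^{-\lambda})(r-bT)},$$ $$k^{\max}(T)=\min\left(\frac{(1-t(1-e^{-\lambda}))(T(1-b)+b)}{t(1-e^{-\lambda})(r-b-T(1-b))},\,1\right)\ \text{ if } r-b-T(1-b)>0,\qquad k^{\max}(T)=1\ \text{ otherwise.}$$ **Proposition.** 1. (Non-raters, necessary bound, $\alpha=\tfrac12$.) Let $T\in[0,1]$ and suppose that $m_N<N$ for all large $N$. If $\limsup_N P_N^{1/2}\ge T$, then $k\ge k^{\min}(T)$. 2. (Non-raters, sufficient bound, every $\alpha\in[\tfrac12,1)$.) Let $T\in[0,1]$. If $k\ge k^{\max}(T)$ (where, in case $k^{\max}(T)=1$, this means that all users are raters: $m_N=N$ for all large $N$), then $\liminf_N P_N^{\alpha}\ge T$. 3. (Whole community, necessary bound, $\alpha=\tfrac12$.) Let $\tilde T\in[0,1]$. There is a unique $T^{\min}\in[0,1]$ with $k^{\min}(T^{\min})\le 1$ and $(1-k^{\min}(T^{\min}))(1-T^{\min})=1-\tilde T$. If $\limsup_N C_N^{1/2}\ge\tilde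 T$, then $k\ge k^{\min}(T^{\min})$. 4. (Whole community, sufficient bound, every $\alpha\in[\tfrac12,1)$.) Let $\tilde T\in[0,1]$. The equation $(1-k^{\max}(T))(1-T)=1-\tilde T$ has a real solution $T\le 1$; it has only one real solution if $\tilde T<1$; and it has a solution in $[0,1]$ if $\tilde T\ge k^{\max}(0)$. For every real solution $T^{\max}$, if $k\ge k^{\max}(T^{\max})$, then $\liminf_N C_N^{\alpha}\ge\tilde T$. -/

import Mathlib

namespace TrustModel

/-- `N(i)`: the users that user `i` trusts; an edge `(i, j)` means that `i` trusts `j`. -/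
def trustees {V : Type*} [Fintype V] [DecidableEq V] (E : Finset (V × V)) (i : V) : Finset V :=
  Finset.univ.filter fun j => (i, j) ∈ E

/-- Weight given to the opinion of user `j`: `α` for a rater, `1 - α` for a non-rater. -/
def opinionWeight {V : Type*} [DecidableEq V] (α : ℝ) (R : Finset V) (j : V) : ℝ :=
  if j ∈ R then α else 1 - α

/-- User `i` is a rater, or trusts (directly or indirectly) some rater. -/
def ReachesRater {V : Type*} (E : Finset (V × V)) (R : Finset V) (i : V) : Prop :=
  ∃ j ∈ R, Relation.ReflTransGen (fun a c => (a, c) ∈ E) i j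

/-- `s` is a vector of satisfaction scores for the trust graph `E` with trust values `t`,
set of raters `R`, ratings `ρ` and weight parameter `α`: raters have their own rating as score,
the score of a non-rater is the weighted mean of the discounted scores of the users he trusts,
and users who do not trust any rater, even indirectly, have score `0`. -/
structure IsScore {V : Type*} [Fintype V] [DecidableEq V] (α : ℝ) (E : Finset (V × V))
    (t : V → V → ℝ) (R : Finset V) (ρ : V → ℝ) (s : V → ℝ) : Prop where
  rater : ∀ i ∈ R, s i = ρ i
  nonRater : ∀ i ∉ R, (trustees E i).Nonempty →
    s i = (∑ j ∈ trustees E i, opinionWeight α R j * t i j ^ 2 * s j) /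
      (∑ j ∈ trustees E i, opinionWeight α R j * t i j)
  unreached : ∀ i, ¬ ReachesRater E R i → s i = 0

/-- The vector of satisfaction scores (see `existsUnique_isScore` for existence and uniqueness
when `0 < α < 1` and the trust values lie in `(0, 1]`). -/
noncomputable def score {V : Type*} [Fintype V] [DecidableEq V] (α : ℝ) (E : Finset (V × V))
    (t : V → V → ℝ) (R : Finset V) (ρ : V → ℝ) : V → ℝ :=
  Classical.epsilon (IsScore α E t R ρ)

theorem opinionWeight_pos {V : Type*} [DecidableEq V] {α : ℝ} (h0 : 0 < α) (h1 : α < 1)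
    (R : Finset V) (j : V) : 0 < opinionWeight α R j := by
  unfold opinionWeight
  split_ifs <;> linarith

theorem score_maximum {V : Type*} [Fintype V] [DecidableEq V] {α : ℝ}
    (h0 : 0 < α) (h1 : α < 1) (E : Finset (V × V)) (t : V → V → ℝ)
    (ht : ∀ i j, 0 < t i j ∧ t i j ≤ 1) (R : Finset V) (s : V → ℝ)
    (hr : ∀ i ∈ R, s i = 0) (hu : ∀ i, ¬ ReachesRater E R i → s i = 0)
    (hn : ∀ i ∉ R, ReachesRater E R i →
      s i * (∑ j ∈ trustees E i, opinionWeight α R j * t i j) =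
        ∑ j ∈ trustees E i, opinionWeight α R j * t i j ^ 2 * s j) (i : V) : s i ≤ 0 := by
  by_contra hi
  push Not at hi
  obtain ⟨m, -, hm⟩ := Finset.exists_max_image (Finset.univ : Finset V) s ⟨i, Finset.mem_univ i⟩
  have hM : 0 < s m := lt_of_lt_of_le hi (hm i (Finset.mem_univ i))
  have hmr : ReachesRater E R m := by
    by_contra h
    exact hM.ne' (hu m h)
  obtain ⟨j, hj, hpath⟩ := hmr
  have key : ∀ a, Relation.ReflTransGen (fun a c => (a, c) ∈ E) a j → s a = s m → False := by
    intro a ha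
    induction ha using Relation.ReflTransGen.head_induction_on with
    | refl => intro h; rw [hr j hj] at h; exact hM.ne h
    | head hac hcj ih =>
      rename_i a c
      intro hsa
      have haR : a ∉ R := fun h => hM.ne' (hsa ▸ hr a h)
      have heq := hn a haR ⟨j, hj, Relation.ReflTransGen.head hac hcj⟩
      have hc : c ∈ trustees E a := by simpa [trustees] using hac
      have hle : ∀ x, t a x * s x ≤ s m := by
        intro x
        have hx := hm x (Finset.mem_univ x)
        obtain ⟨p, q⟩ := ht a x
        nlinarith [mul_nonneg (sub_nonneg.2 q) hM.le, mul_nonneg p.le (sub_nonneg.2 hx)]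
      have hz : ∑ x ∈ trustees E a, opinionWeight α R x * t a x * (s m - t a x * s x) = 0 := by
        have : ∑ x ∈ trustees E a, opinionWeight α R x * t a x * (s m - t a x * s x) =
            s m * (∑ j ∈ trustees E a, opinionWeight α R j * t a j) -
              ∑ j ∈ trustees E a, opinionWeight α R j * t a j ^ 2 * s j := by
          rw [Finset.mul_sum, ← Finset.sum_sub_distrib]
          exact Finset.sum_congr rfl fun x _ => by ring
        rw [this, ← hsa, heq, sub_self]
      have hw : ∀ x, 0 < opinionWeight α R x * t a x := fun x =>
        mul_pos (opinionWeight_pos h0 h1 R x) (ht a x).1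
      rw [Finset.sum_eq_zero_iff_of_nonneg
        (fun x _ => mul_nonneg (hw x).le (sub_nonneg.2 (hle x)))] at hz
      have h3 : s m - t a c * s c = 0 := (mul_eq_zero.1 (hz c hc)).resolve_left (hw c).ne'
      apply ih
      have hx := hm c (Finset.mem_univ c)
      obtain ⟨p, q⟩ := ht a c
      apply le_antisymm hx
      by_contra hlt
      push Not at hlt
      nlinarith [mul_pos p (sub_pos.2 hlt), mul_nonneg (sub_nonneg.2 q) hM.le]
  exact key m hpath rfl

theorem existsUnique_isScore {V : Type*} [Fintype V] [DecidableEq V] {α : ℝ}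
    (h0 : 0 < α) (h1 : α < 1) (E : Finset (V × V)) (t : V → V → ℝ)
    (ht : ∀ i j, 0 < t i j ∧ t i j ≤ 1) (R : Finset V) (ρ : V → ℝ) :
    ∃! s, IsScore α E t R ρ s := by
  classical
  have hne : ∀ i ∉ R, ReachesRater E R i → (trustees E i).Nonempty := by
    rintro i hi ⟨j, hj, hp⟩
    rcases Relation.ReflTransGen.cases_head hp with h | ⟨c, hc, -⟩
    · exact absurd (h ▸ hj) hi
    · exact ⟨c, by simpa [trustees] using hc⟩
  have hden : ∀ i, (trustees E i).Nonempty →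
      0 < ∑ j ∈ trustees E i, opinionWeight α R j * t i j := fun i hi =>
    Finset.sum_pos (fun j _ => mul_pos (opinionWeight_pos h0 h1 R j) (ht i j).1) hi
  let L : (V → ℝ) →ₗ[ℝ] (V → ℝ) :=
    { toFun := fun s i =>
        if i ∈ R ∨ ¬ ReachesRater E R i then s i else
          s i * (∑ j ∈ trustees E i, opinionWeight α R j * t i j) -
            ∑ j ∈ trustees E i, opinionWeight α R j * t i j ^ 2 * s j
      map_add' := by
        intro x y
        funext i
        simp only [Pi.add_apply]
        split_ifs
        · rfl
        · simp only [mul_add, Finset.sum_add_distrib]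
          ring
      map_smul' := by
        intro c x
        funext i
        simp only [Pi.smul_apply, smul_eq_mul, RingHom.id_apply]
        split_ifs
        · rfl
        · have h : ∑ j ∈ trustees E i, opinionWeight α R j * t i j ^ 2 * (c * x j) =
              c * ∑ j ∈ trustees E i, opinionWeight α R j * t i j ^ 2 * x j := by
            rw [Finset.mul_sum]
            exact Finset.sum_congr rfl fun j _ => by ring
          rw [h]
          ring }
  have hL : ∀ s i, L s i = if i ∈ R ∨ ¬ ReachesRater E R i then s i else
          s i * (∑ j ∈ trustees E i, opinionWeight α R j * t i j) -
            ∑ j ∈ trustees E i, opinionWeight α R j * t i j ^ 2 * s j := fun s i => rfl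
  have hle : ∀ s, L s = 0 → ∀ i, s i ≤ 0 := by
    intro s hs
    have hs' : ∀ i, L s i = 0 := fun i => by rw [hs]; rfl
    apply score_maximum h0 h1 E t ht R s
    · intro i hi
      have := hs' i
      rwa [hL, if_pos (Or.inl hi)] at this
    · intro i hi
      have := hs' i
      rwa [hL, if_pos (Or.inr hi)] at this
    · intro i hi hi'
      have := hs' i
      rw [hL, if_neg (by tauto)] at this
      linarith
  have hinj : Function.Injective L := by
    rw [← LinearMap.ker_eq_bot, LinearMap.ker_eq_bot']
    intro s hs
    funext i
    have a := hle s hs i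
    have c := hle (-s) (by rw [map_neg, hs, neg_zero]) i
    simp only [Pi.neg_apply] at c
    simp only [Pi.zero_apply]
    linarith
  obtain ⟨s, hs⟩ := LinearMap.injective_iff_surjective.1 hinj (fun i => if i ∈ R then ρ i else 0)
  have hs' : ∀ i, L s i = if i ∈ R then ρ i else 0 := fun i => by rw [hs]
  have hunr : ∀ i, ¬ ReachesRater E R i → s i = 0 := by
    intro i hi
    have hiR : i ∉ R := fun h => hi ⟨i, h, Relation.ReflTransGen.refl⟩
    have := hs' i
    rwa [hL, if_pos (Or.inr hi), if_neg hiR] at this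
  refine ⟨s, ⟨?_, ?_, hunr⟩, ?_⟩
  · intro i hi
    have := hs' i
    rwa [hL, if_pos (Or.inl hi), if_pos hi] at this
  · intro i hi hi'
    by_cases hri : ReachesRater E R i
    · have := hs' i
      rw [hL, if_neg (by tauto), if_neg hi] at this
      rw [eq_div_iff (hden i hi').ne']
      linarith
    · rw [hunr i hri, Finset.sum_eq_zero, zero_div]
      intro j hj
      rw [hunr j, mul_zero]
      rintro ⟨c, hc, hp⟩
      exact hri ⟨c, hc, Relation.ReflTransGen.head (by simpa [trustees] using hj) hp⟩
  · intro s' h'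
    apply hinj
    funext i
    rw [hs', hL]
    by_cases hi : i ∈ R
    · rw [if_pos (Or.inl hi), if_pos hi, h'.rater i hi]
    · rw [if_neg hi]
      by_cases hri : ReachesRater E R i
      · have hnn := hne i hi hri
        rw [if_neg (by tauto), h'.nonRater i hi hnn, div_mul_cancel₀ _ (hden i hnn).ne', sub_self]
      · rw [if_pos (Or.inr hri), h'.unreached i hri]

/-- Proportion of the users in `A` that are satisfied, i.e. whose score exceeds the threshold `b`.
It is written as one minus the proportion of unsatisfied users, so that it equals `1` if `A` is
empty (nobody is left to be satisfied). -/
noncomputable def satisfiedProportion {V : Type*} (A : Finset V) (s : V → ℝ) (b : ℝ) : ℝ :=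
  1 - ((A.filter fun i => s i ≤ b).card : ℝ) / (A.card : ℝ)

/-- Expectation of `f E R`, where `E` is the edge set of a directed Erdős–Rényi graph on `N`
users (each of the `N (N - 1)` possible edges is present independently with probability
`min (lam / N) 1`), and `R` is, independently of `E`, a uniformly distributed set of `m` users. -/
noncomputable def expectation (N : ℕ) (lam : ℝ) (m : ℕ)
    (f : Finset (Fin N × Fin N) → Finset (Fin N) → ℝ) : ℝ :=
  ∑ E ∈ (Finset.univ : Finset (Fin N)).offDiag.powerset,
    ∑ R ∈ Finset.powersetCard m (Finset.univ : Finset (Fin N)),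
      (min (lam / N) 1) ^ E.card * (1 - min (lam / N) 1) ^ (N * (N - 1) - E.card) *
        ((N.choose m : ℝ))⁻¹ * f E R

/-- Expected proportion of satisfied users among the non-raters, when all trust values are `t`,
all ratings are `r` and there are `m` raters. -/
noncomputable def nonRaterSatisfaction (α lam t r b : ℝ) (N m : ℕ) : ℝ :=
  expectation N lam m fun E R =>
    satisfiedProportion Rᶜ (score α E (fun _ _ => t) R (fun _ => r)) b

/-- Expected proportion of satisfied users in the whole community, when all trust values are `t`,
all ratings are `r` and there are `m` raters. -/
noncomputable def communitySatisfaction (α lam t r b : ℝ) (N m : ℕ) : ℝ :=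
  expectation N lam m fun E R =>
    satisfiedProportion Finset.univ (score α E (fun _ _ => t) R (fun _ => r)) b

/-- The bound `k^min(T)`. -/
noncomputable def kMin (lam t r b T : ℝ) : ℝ :=
  b * T * (1 - t * (1 - Real.exp (-lam))) / (t * (1 - Real.exp (-lam)) * (r - b * T))

/-- The bound `k^max(T)`; it is the trivial bound `1` when `r - b - T (1 - b) ≤ 0`. -/
noncomputable def kMax (lam t r b T : ℝ) : ℝ :=
  if 0 < r - b - T * (1 - b) then
    min ((1 - t * (1 - Real.exp (-lam))) * (T * (1 - b) + b) /
      (t * (1 - Real.exp (-lam)) * (r - b - T * (1 - b)))) 1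
  else 1

end TrustModel

/-!
Let `θ = t * (1 - exp (-lam))`, the limit of `t` times the probability that a user trusts somebody.
For `α = 1 / 2` the score of a non-rater is `t` times the plain mean of the scores of the users he
trusts. If these scores were independent of whom he trusts, the expected score `x` of a non-rater
would solve `x = θ * (k * r + (1 - k) * x)` in the limit, that is, `x = θ k r / (1 - θ (1 - k))`,
which is `limitScore θ r k`. The inequalities between `k` and `kMin T` or `kMax T` are exactly those
between `b * T` or `b + T * (1 - b)` and this value. They follow from Markov's inequality, applied
to the score and to one minus the score.

The dependence is removed by comparison rather than by a coupling of the graph with a tree. By the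
maximum principle `nonpos_of_subsolution`, the scores decrease if a user `i` stops trusting anybody
(`score_dropRows_le`), and increase if in addition `i` becomes a rater (`score_le_dropRows_union`).
Both modified scores no longer depend on whom `i` trusts, so `randomSubsetMean_trustees` computes
the expectation of their mean over the users trusted by `i`. Repeating this a fixed number `l` of
times costs only `l` modified users, a negligible proportion, and gives a lower and an upper bound
(`exploredScore` with `v = 0` and `v = r`) that differ in the limit from the fixed point by a
multiple of `(θ (1 - k)) ^ l`, which is small because `θ < 1`.

For larger `α` the scores only increase (`score_half_le`), so that the case `α = 1 / 2` also gives
the sufficient bounds. With `U` the expected number of unsatisfied non-raters, the two satisfied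
proportions are `1 - U / (N - m)` and `1 - U / N`, since raters are always satisfied. The solutions
of the equations for `T^min` and `T^max` come from the intermediate value theorem and strict
monotonicity.
-/

namespace TrustModel

/-! ### Comparison of satisfaction scores -/

section Scores

variable {V : Type*} [Fintype V] [DecidableEq V]

/-- Comparison principle: a function which, wherever it is positive, is at most `t ≤ 1` times its
weighted mean over the trusted users, cannot be positive anywhere. A positive maximum would
propagate along a path to a rater, where the function is not positive. -/
theorem nonpos_of_subsolution {α t : ℝ} (h0 : 0 < α) (h1 : α < 1) (ht0 : 0 < t) (ht1 : t ≤ 1)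
    {E : Finset (V × V)} {R : Finset V} (u : V → ℝ)
    (hu : ∀ i, 0 < u i → i ∉ R ∧ ReachesRater E R i ∧
      u i * ∑ j ∈ trustees E i, opinionWeight α R j ≤
        t * ∑ j ∈ trustees E i, opinionWeight α R j * u j) (i : V) : u i ≤ 0 := by
  by_contra hi
  push Not at hi
  obtain ⟨m, -, hm⟩ := Finset.exists_max_image (Finset.univ : Finset V) u ⟨i, Finset.mem_univ i⟩
  have hM : 0 < u m := lt_of_lt_of_le hi (hm i (Finset.mem_univ i))
  obtain ⟨j, hj, hpath⟩ := (hu m hM).2.1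
  have key : ∀ a, Relation.ReflTransGen (fun a c => (a, c) ∈ E) a j → u a = u m → False := by
    intro a ha
    induction ha using Relation.ReflTransGen.head_induction_on with
    | refl => exact fun h => (hu j (h ▸ hM)).1 hj
    | head hac hcj ih =>
      rename_i a c
      intro hsa
      obtain ⟨-, -, hle⟩ := hu a (hsa ▸ hM)
      have hc : c ∈ trustees E a := by simpa [trustees] using hac
      have hw : ∀ x, 0 < opinionWeight α R x := opinionWeight_pos h0 h1 R
      have hW : 0 < ∑ x ∈ trustees E a, opinionWeight α R x :=
        Finset.sum_pos (fun x _ => hw x) ⟨c, hc⟩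
      have hpos : 0 < ∑ x ∈ trustees E a, opinionWeight α R x * u x :=
        pos_of_mul_pos_right (lt_of_lt_of_le (mul_pos (hsa ▸ hM) hW) hle) ht0.le
      have hle1 : u m * ∑ x ∈ trustees E a, opinionWeight α R x ≤
          ∑ x ∈ trustees E a, opinionWeight α R x * u x := by
        rw [hsa] at hle
        exact hle.trans (mul_le_of_le_one_left hpos.le ht1)
      apply ih
      by_contra hne
      have hlt : u c < u m := lt_of_le_of_ne (hm c (Finset.mem_univ c)) hne
      have : ∑ x ∈ trustees E a, opinionWeight α R x * u x <
          ∑ x ∈ trustees E a, opinionWeight α R x * u m := by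
        refine Finset.sum_lt_sum (fun x _ => ?_) ⟨c, hc, ?_⟩
        · exact mul_le_mul_of_nonneg_left (hm x (Finset.mem_univ x)) (hw x).le
        · exact mul_lt_mul_of_pos_left hlt (hw c)
      rw [← Finset.sum_mul] at this
      linarith
  exact key m hpath rfl

/-- The trust graph in which the users of `S` do not trust anybody. -/
def dropRows {V : Type*} [DecidableEq V] (S : Finset V) (E : Finset (V × V)) :
    Finset (V × V) :=
  E.filter fun e => e.1 ∉ S

theorem dropRows_insert {V : Type*} [DecidableEq V] (E : Finset (V × V)) (S : Finset V) (i : V) :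
    dropRows (insert i S) E = dropRows {i} (dropRows S E) := by
  ext e
  simp only [dropRows, Finset.mem_filter, Finset.mem_insert, Finset.mem_singleton]
  tauto

theorem trustees_dropRows (E : Finset (V × V)) {S : Finset V} {i : V} (hi : i ∉ S) :
    trustees (dropRows S E) i = trustees E i := by
  ext j
  simp [trustees, dropRows, hi]

theorem ReachesRater.of_dropRows {V : Type*} [DecidableEq V] {S : Finset V} {i : V}
    {E : Finset (V × V)} {R : Finset V} (h : ReachesRater (dropRows S E) R i) : ReachesRater E R i := by
  obtain ⟨j, hj, hp⟩ := h
  exact ⟨j, hj, Relation.ReflTransGen.mono (fun a c hac => (Finset.mem_filter.1 hac).1) i j hp⟩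

section Basic

variable {α t r : ℝ} (h0 : 0 < α) (h1 : α < 1) (ht0 : 0 < t) (ht1 : t ≤ 1)
  (E : Finset (V × V)) (R : Finset V)

include h0 h1 ht0 ht1

theorem score_isScore (ρ : V → ℝ) :
    IsScore α E (fun _ _ => t) R ρ (score α E (fun _ _ => t) R ρ) :=
  Classical.epsilon_spec (existsUnique_isScore h0 h1 E (fun _ _ => t) (fun _ _ => ⟨ht0, ht1⟩) R
    ρ).exists

theorem score_rater {i : V} (hi : i ∈ R) : score α E (fun _ _ => t) R (fun _ => r) i = r :=
  (score_isScore h0 h1 ht0 ht1 E R _).rater i hi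

theorem score_unreached {i : V} (hi : ¬ ReachesRater E R i) :
    score α E (fun _ _ => t) R (fun _ => r) i = 0 :=
  (score_isScore h0 h1 ht0 ht1 E R _).unreached i hi

/-- The score equation of a non-rater, cleared of denominators; it also holds when the user trusts
nobody. -/
theorem score_mul_sum {i : V} (hi : i ∉ R) :
    score α E (fun _ _ => t) R (fun _ => r) i * ∑ j ∈ trustees E i, opinionWeight α R j =
      t * ∑ j ∈ trustees E i,
        opinionWeight α R j * score α E (fun _ _ => t) R (fun _ => r) j := by
  rcases (trustees E i).eq_empty_or_nonempty with he | hne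
  · simp [he]
  · have hW : 0 < ∑ x ∈ trustees E i, opinionWeight α R x :=
      Finset.sum_pos (fun x _ => opinionWeight_pos h0 h1 R x) hne
    rw [(score_isScore h0 h1 ht0 ht1 E R _).nonRater i hi hne, ← Finset.sum_mul,
      div_mul_eq_mul_div, div_eq_iff (mul_pos hW ht0).ne']
    have : ∑ j ∈ trustees E i, opinionWeight α R j * t ^ 2 *
        score α E (fun _ _ => t) R (fun _ => r) j = t ^ 2 * ∑ j ∈ trustees E i,
        opinionWeight α R j * score α E (fun _ _ => t) R (fun _ => r) j := by
      rw [Finset.mul_sum]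
      exact Finset.sum_congr rfl fun x _ => by ring
    rw [this]
    ring

theorem score_nonneg (hr : 0 < r) (i : V) :
    0 ≤ score α E (fun _ _ => t) R (fun _ => r) i := by
  have := nonpos_of_subsolution (E := E) (R := R) h0 h1 ht0 ht1
    (fun i => - score α E (fun _ _ => t) R (fun _ => r) i) (fun i hi => ?_) i
  · linarith
  · have hiR : i ∉ R := fun h => by
      rw [score_rater h0 h1 ht0 ht1 E R h] at hi
      linarith
    refine ⟨hiR, ?_, ?_⟩
    · by_contra h
      rw [score_unreached h0 h1 ht0 ht1 E R h] at hi
      linarith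
    · simp only [mul_neg, Finset.sum_neg_distrib, neg_mul]
      rw [score_mul_sum h0 h1 ht0 ht1 E R hiR]

theorem score_le (hr : 0 < r) (i : V) :
    score α E (fun _ _ => t) R (fun _ => r) i ≤ r := by
  have := nonpos_of_subsolution (E := E) (R := R) h0 h1 ht0 ht1
    (fun i => score α E (fun _ _ => t) R (fun _ => r) i - r) (fun i hi => ?_) i
  · linarith
  · have hiR : i ∉ R := fun h => by
      rw [score_rater h0 h1 ht0 ht1 E R h] at hi
      linarith
    refine ⟨hiR, ?_, ?_⟩
    · by_contra h
      rw [score_unreached h0 h1 ht0 ht1 E R h] at hi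
      linarith
    · simp only [mul_sub, Finset.sum_sub_distrib, sub_mul]
      rw [score_mul_sum h0 h1 ht0 ht1 E R hiR, ← Finset.sum_mul]
      have hW : 0 ≤ ∑ x ∈ trustees E i, opinionWeight α R x :=
        Finset.sum_nonneg fun x _ => (opinionWeight_pos h0 h1 R x).le
      nlinarith [mul_nonneg (mul_nonneg hW hr.le) (sub_nonneg.2 ht1)]

end Basic

variable {t r : ℝ} (ht0 : 0 < t) (ht1 : t ≤ 1) (hr : 0 < r) (E : Finset (V × V)) (R : Finset V)

include ht0 ht1

/-- For equal weights, the score of a non-rater is `t` times the plain mean of the scores of the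
users he trusts. -/
theorem score_half_nonRater {i : V} (hi : i ∉ R) :
    score (1 / 2) E (fun _ _ => t) R (fun _ => r) i =
      t * ((∑ j ∈ trustees E i, score (1 / 2) E (fun _ _ => t) R (fun _ => r) j) /
        (trustees E i).card) := by
  have hw : ∀ j, opinionWeight (1 / 2 : ℝ) R j = 1 / 2 := fun j => by
    unfold opinionWeight
    split_ifs <;> norm_num
  rcases (trustees E i).eq_empty_or_nonempty with he | hne
  · rw [he, Finset.sum_empty, zero_div, mul_zero]
    refine score_unreached (by norm_num) (by norm_num) ht0 ht1 E R ?_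
    rintro ⟨j, hj, hp⟩
    rcases Relation.ReflTransGen.cases_head hp with h | ⟨c, hc, -⟩
    · exact hi (h ▸ hj)
    · have : c ∈ trustees E i := by simpa [trustees] using hc
      simp [he] at this
  · have hcard : (0 : ℝ) < (trustees E i).card := by exact_mod_cast hne.card_pos
    have h := score_mul_sum (r := r) (by norm_num) (by norm_num) ht0 ht1 E R (α := 1 / 2) hi
    simp only [hw, ← Finset.mul_sum, Finset.sum_const, nsmul_eq_mul] at h
    rw [mul_div_assoc', eq_div_iff hcard.ne']
    linarith

include hr

/-- Scores do not decrease when the opinions of the raters get more weight than those of the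
others, because no score exceeds the common rating `r`. -/
theorem score_half_le {α : ℝ} (h0 : 1 / 2 ≤ α) (h1 : α < 1) (i : V) :
    score (1 / 2) E (fun _ _ => t) R (fun _ => r) i ≤
      score α E (fun _ _ => t) R (fun _ => r) i := by
  have hα : 0 < α := by linarith
  have hh0 : (0 : ℝ) < 1 / 2 := by norm_num
  have hh1 : (1 / 2 : ℝ) < 1 := by norm_num
  set s := score (1 / 2) E (fun _ _ => t) R (fun _ => r) with hs
  set s' := score α E (fun _ _ => t) R (fun _ => r) with hs'
  have := nonpos_of_subsolution (E := E) (R := R) hα h1 ht0 ht1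
    (fun i => s i - s' i) (fun i hi => ?_) i
  · linarith
  · have hiR : i ∉ R := fun h => by
      rw [hs, hs', score_rater hα h1 ht0 ht1 E R h, score_rater hh0 hh1 ht0 ht1 E R h] at hi
      linarith
    refine ⟨hiR, ?_, ?_⟩
    · by_contra h
      rw [hs, hs', score_unreached hα h1 ht0 ht1 E R h,
        score_unreached hh0 hh1 ht0 ht1 E R h] at hi
      linarith
    · simp only [mul_sub, Finset.sum_sub_distrib, sub_mul]
      rw [hs', score_mul_sum hα h1 ht0 ht1 E R hiR]
      refine sub_le_sub_right ?_ _
      have hmean := score_half_nonRater (r := r) ht0 ht1 E R hiR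
      rw [← hs] at hmean
      rcases (trustees E i).eq_empty_or_nonempty with he | hne
      · simp [he]
      have hcard : (0 : ℝ) < (trustees E i).card := by exact_mod_cast hne.card_pos
      set μ := (∑ j ∈ trustees E i, s j) / (trustees E i).card with hμ
      have hsum : ∑ j ∈ trustees E i, (s j - μ) = 0 := by
        rw [Finset.sum_sub_distrib, Finset.sum_const, nsmul_eq_mul, hμ,
          mul_div_cancel₀ _ hcard.ne', sub_self]
      have hμr : μ ≤ r := by
        rw [hμ, div_le_iff₀ hcard, mul_comm, ← nsmul_eq_mul]
        exact Finset.sum_le_card_nsmul _ _ _ fun j _ => score_le hh0 hh1 ht0 ht1 E R hr j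
      -- Subtracting the constant weight `1 - α` leaves a nonnegative weight on the raters only.
      have hnn : 0 ≤ ∑ j ∈ trustees E i, opinionWeight α R j * (s j - μ) := by
        have h2 : ∑ j ∈ trustees E i, opinionWeight α R j * (s j - μ) =
            ∑ j ∈ trustees E i, (opinionWeight α R j - (1 - α)) * (s j - μ) := by
          simp only [sub_mul (opinionWeight α R _), Finset.sum_sub_distrib (s := trustees E i)
            (fun j => opinionWeight α R j * (s j - μ)), ← Finset.mul_sum, hsum]
          ring
        rw [h2]
        refine Finset.sum_nonneg fun j _ => ?_
        by_cases hj : j ∈ R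
        · rw [hs, score_rater hh0 hh1 ht0 ht1 E R hj]
          simp only [opinionWeight, if_pos hj]
          exact mul_nonneg (by linarith) (by linarith)
        · simp [opinionWeight, if_neg hj]
      simp only [mul_sub, Finset.sum_sub_distrib, ← Finset.sum_mul] at hnn
      rw [hmean, mul_assoc]
      refine mul_le_mul_of_nonneg_left ?_ ht0.le
      linarith

theorem score_dropRows_le (S : Finset V) (i : V) :
    score (1 / 2) (dropRows S E) (fun _ _ => t) R (fun _ => r) i ≤
      score (1 / 2) E (fun _ _ => t) R (fun _ => r) i := by
  have hh0 : (0 : ℝ) < 1 / 2 := by norm_num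
  have hh1 : (1 / 2 : ℝ) < 1 := by norm_num
  set s := score (1 / 2) E (fun _ _ => t) R (fun _ => r) with hs
  set s' := score (1 / 2) (dropRows S E) (fun _ _ => t) R (fun _ => r) with hs'
  have := nonpos_of_subsolution (E := E) (R := R) hh0 hh1 ht0 ht1
    (fun i => s' i - s i) (fun i hi => ?_) i
  · linarith
  · have hnn : 0 ≤ s i := score_nonneg hh0 hh1 ht0 ht1 E R hr i
    have hreach : ReachesRater (dropRows S E) R i := by
      by_contra h
      rw [hs', score_unreached hh0 hh1 ht0 ht1 _ R h] at hi
      linarith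
    have hiR : i ∉ R := fun h => by
      rw [hs, hs', score_rater hh0 hh1 ht0 ht1 _ R h, score_rater hh0 hh1 ht0 ht1 E R h] at hi
      linarith
    have hiS : i ∉ S := fun h => by
      obtain ⟨j, hj, hp⟩ := hreach
      rcases Relation.ReflTransGen.cases_head hp with e | ⟨c, hc, -⟩
      · exact hiR (e ▸ hj)
      · exact (Finset.mem_filter.1 hc).2 h
    refine ⟨hiR, hreach.of_dropRows, ?_⟩
    simp only [mul_sub, Finset.sum_sub_distrib, sub_mul]
    have h1 := score_mul_sum (r := r) hh0 hh1 ht0 ht1 E R hiR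
    have h2 := score_mul_sum (r := r) hh0 hh1 ht0 ht1 (dropRows S E) R hiR
    rw [trustees_dropRows E hiS] at h2
    rw [hs', hs, h1, h2]

theorem score_le_dropRows_union (S : Finset V) (i : V) :
    score (1 / 2) E (fun _ _ => t) R (fun _ => r) i ≤
      score (1 / 2) (dropRows S E) (fun _ _ => t) (R ∪ S) (fun _ => r) i := by
  have hh0 : (0 : ℝ) < 1 / 2 := by norm_num
  have hh1 : (1 / 2 : ℝ) < 1 := by norm_num
  set s := score (1 / 2) E (fun _ _ => t) R (fun _ => r) with hs
  set s' := score (1 / 2) (dropRows S E) (fun _ _ => t) (R ∪ S) (fun _ => r) with hs'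
  have := nonpos_of_subsolution (E := E) (R := R) hh0 hh1 ht0 ht1
    (fun i => s i - s' i) (fun i hi => ?_) i
  · linarith
  · have hnn : 0 ≤ s' i := score_nonneg hh0 hh1 ht0 ht1 _ _ hr i
    have hler : s i ≤ r := score_le hh0 hh1 ht0 ht1 E R hr i
    have hiRS : i ∉ R ∪ S := fun h => by
      rw [hs', score_rater hh0 hh1 ht0 ht1 _ _ h] at hi
      linarith
    have hiR : i ∉ R := fun h => hiRS (Finset.mem_union_left _ h)
    have hiS : i ∉ S := fun h => hiRS (Finset.mem_union_right _ h)
    refine ⟨hiR, ?_, ?_⟩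
    · by_contra h
      rw [hs, score_unreached hh0 hh1 ht0 ht1 _ R h] at hi
      linarith
    · -- Both weights are `1 / 2`, so the equations for the two sets of raters agree.
      have hw : ∀ (Q : Finset V) j, opinionWeight (1 / 2 : ℝ) Q j = 1 / 2 := fun Q j => by
        unfold opinionWeight
        split_ifs <;> norm_num
      have h1 := score_mul_sum (r := r) hh0 hh1 ht0 ht1 E R hiR
      have h2 := score_mul_sum (r := r) hh0 hh1 ht0 ht1 (dropRows S E) (R ∪ S) hiRS
      rw [trustees_dropRows E hiS] at h2
      simp only [hw] at h1 h2
      simp only [mul_sub, Finset.sum_sub_distrib, sub_mul, hw]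
      rw [hs', hs, h1, h2]

end Scores

/-! ### Random subsets -/

section RandomSubset

variable {ι : Type*}

/-- Expectation of `f F`, where `F` is the random subset of `A` that contains each element of `A`
independently with probability `q`. -/
noncomputable def randomSubsetMean (q : ℝ) (A : Finset ι) (f : Finset ι → ℝ) : ℝ :=
  ∑ F ∈ A.powerset, q ^ F.card * (1 - q) ^ (A.card - F.card) * f F

theorem randomSubsetMean_mono {q : ℝ} (hq0 : 0 ≤ q) (hq1 : q ≤ 1) {A : Finset ι}
    {f g : Finset ι → ℝ} (h : ∀ F ⊆ A, f F ≤ g F) :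
    randomSubsetMean q A f ≤ randomSubsetMean q A g :=
  Finset.sum_le_sum fun F hF => mul_le_mul_of_nonneg_left (h F (Finset.mem_powerset.1 hF))
    (mul_nonneg (pow_nonneg hq0 _) (pow_nonneg (sub_nonneg.2 hq1) _))

theorem randomSubsetMean_congr (q : ℝ) {A : Finset ι} {f g : Finset ι → ℝ}
    (h : ∀ F ⊆ A, f F = g F) : randomSubsetMean q A f = randomSubsetMean q A g :=
  Finset.sum_congr rfl fun F hF => by rw [h F (Finset.mem_powerset.1 hF)]

theorem randomSubsetMean_const_mul (q c : ℝ) (A : Finset ι) (f : Finset ι → ℝ) :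
    randomSubsetMean q A (fun F => c * f F) = c * randomSubsetMean q A f := by
  unfold randomSubsetMean
  rw [Finset.mul_sum]
  exact Finset.sum_congr rfl fun F _ => by ring

theorem randomSubsetMean_sum {κ : Type*} (q : ℝ) (A : Finset ι) (B : Finset κ)
    (f : κ → Finset ι → ℝ) :
    randomSubsetMean q A (fun F => ∑ j ∈ B, f j F) = ∑ j ∈ B, randomSubsetMean q A (f j) := by
  unfold randomSubsetMean
  rw [Finset.sum_comm]
  exact Finset.sum_congr rfl fun F _ => by rw [Finset.mul_sum]

variable [DecidableEq ι]

theorem randomSubsetMean_insert (q : ℝ) {A : Finset ι} {a : ι} (ha : a ∉ A)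
    (f : Finset ι → ℝ) :
    randomSubsetMean q (insert a A) f =
      (1 - q) * randomSubsetMean q A f + q * randomSubsetMean q A (fun F => f (insert a F)) := by
  unfold randomSubsetMean
  rw [Finset.sum_powerset_insert ha, Finset.mul_sum, Finset.mul_sum]
  congr 1 <;> refine Finset.sum_congr rfl fun F hF => ?_
  · have hF' := Finset.mem_powerset.1 hF
    have := Finset.card_le_card hF'
    rw [Finset.card_insert_of_notMem ha, Nat.succ_sub this, pow_succ]
    ring
  · have hF' := Finset.mem_powerset.1 hF
    rw [Finset.card_insert_of_notMem ha, Finset.card_insert_of_notMem fun h => ha (hF' h),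
      Nat.add_sub_add_right, pow_succ]
    ring

@[simp]
theorem randomSubsetMean_const (q c : ℝ) (A : Finset ι) :
    randomSubsetMean q A (fun _ => c) = c := by
  induction A using Finset.induction_on with
  | empty => simp [randomSubsetMean]
  | insert a A ha ih =>
    rw [randomSubsetMean_insert q ha, ih]
    ring

theorem randomSubsetMean_const_sub_mul (q a c : ℝ) (A : Finset ι) (f : Finset ι → ℝ) :
    randomSubsetMean q A (fun F => a - c * f F) = a - c * randomSubsetMean q A f := by
  have h : randomSubsetMean q A (fun F => a - c * f F) =
      randomSubsetMean q A (fun _ => a) - randomSubsetMean q A (fun F => c * f F) := by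
    unfold randomSubsetMean
    rw [← Finset.sum_sub_distrib]
    exact Finset.sum_congr rfl fun F _ => by ring
  rw [h, randomSubsetMean_const, randomSubsetMean_const_mul]

theorem randomSubsetMean_union (q : ℝ) {A B : Finset ι} (h : Disjoint A B)
    (f : Finset ι → ℝ) :
    randomSubsetMean q (A ∪ B) f =
      randomSubsetMean q A fun F => randomSubsetMean q B fun G => f (F ∪ G) := by
  induction A using Finset.induction_on generalizing f with
  | empty => simp [randomSubsetMean]
  | insert a A ha ih =>
    rw [Finset.disjoint_insert_left] at h
    rw [Finset.insert_union, randomSubsetMean_insert q (by simp [ha, h.1]),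
      randomSubsetMean_insert q ha, ih h.2, ih h.2]
    simp only [Finset.insert_union]

/-- Expectation of `1 / (X + 1)` for a binomial variable `X`. -/
theorem randomSubsetMean_inv_card_add_one {ι : Type*} (q : ℝ) (A : Finset ι) :
    q * ((A.card : ℝ) + 1) * randomSubsetMean q A (fun F => ((F.card : ℝ) + 1)⁻¹) =
      1 - (1 - q) ^ (A.card + 1) := by
  unfold randomSubsetMean
  rw [Finset.sum_powerset_apply_card
    (fun n => q ^ n * (1 - q) ^ (A.card - n) * ((n : ℝ) + 1)⁻¹)]
  have h := add_pow q (1 - q) (A.card + 1)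
  rw [Finset.sum_range_succ'] at h
  simp only [add_sub_cancel, one_pow, pow_zero, Nat.choose_zero_right, Nat.cast_one, mul_one,
    one_mul, Nat.sub_zero, Nat.add_sub_add_right] at h
  refine eq_sub_of_add_eq (Eq.trans ?_ h.symm)
  rw [Finset.mul_sum]
  congr 1
  refine Finset.sum_congr rfl fun n _ => ?_
  have hc : ((A.card + 1).choose (n + 1) : ℝ) =
      ((A.card : ℝ) + 1) * (A.card.choose n : ℝ) * ((n : ℝ) + 1)⁻¹ := by
    rw [eq_mul_inv_iff_mul_eq₀ (by positivity)]
    exact_mod_cast (Nat.add_one_mul_choose_eq A.card n).symm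
  rw [nsmul_eq_mul, pow_succ, hc]
  ring

/-- The mean of `z` over a random subset of `A` (zero if the subset is empty) has as expectation
the mean of `z` over `A`, times the probability that the subset is nonempty. -/
theorem randomSubsetMean_average (q : ℝ) (A : Finset ι) (z : ι → ℝ) :
    randomSubsetMean q A (fun F => (∑ x ∈ F, z x) / F.card) =
      (1 - (1 - q) ^ A.card) / A.card * ∑ x ∈ A, z x := by
  have h1 : randomSubsetMean q A (fun F => (∑ x ∈ F, z x) / F.card) =
      randomSubsetMean q A (fun F => ∑ x ∈ A, z x * if x ∈ F then (F.card : ℝ)⁻¹ else 0) := by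
    refine randomSubsetMean_congr q fun F hF => ?_
    simp only [mul_ite, mul_zero]
    rw [← Finset.sum_filter, Finset.filter_mem_eq_inter, Finset.inter_eq_right.2 hF,
      ← Finset.sum_mul, div_eq_mul_inv]
  rw [h1, randomSubsetMean_sum, Finset.mul_sum]
  refine Finset.sum_congr rfl fun x hx => ?_
  rw [randomSubsetMean_const_mul, mul_comm]
  congr 1
  obtain ⟨B, hxB, rfl⟩ : ∃ B, x ∉ B ∧ insert x B = A :=
    ⟨A.erase x, Finset.notMem_erase x A, Finset.insert_erase hx⟩
  rw [randomSubsetMean_insert q hxB, Finset.card_insert_of_notMem hxB]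
  have h2 : randomSubsetMean q B (fun F => if x ∈ F then (F.card : ℝ)⁻¹ else 0) = 0 := by
    refine (randomSubsetMean_congr q fun F hF => ?_).trans (randomSubsetMean_const q 0 B)
    exact if_neg fun h => hxB (hF h)
  have h3 : randomSubsetMean q B
      (fun F => if x ∈ insert x F then ((insert x F).card : ℝ)⁻¹ else 0) =
      randomSubsetMean q B (fun F => ((F.card : ℝ) + 1)⁻¹) := by
    refine randomSubsetMean_congr q fun F hF => ?_
    rw [if_pos (Finset.mem_insert_self x F), Finset.card_insert_of_notMem fun h => hxB (hF h)]
    push_cast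
    rfl
  rw [h2, h3, ← randomSubsetMean_inv_card_add_one, mul_zero, zero_add]
  have : ((B.card : ℝ) + 1) ≠ 0 := by positivity
  push_cast
  field_simp

end RandomSubset

/-- In a random graph, the mean of `y j` over the users `j` trusted by `i` has the expectation one
expects, provided that `y` does not depend on whom `i` trusts. -/
theorem randomSubsetMean_trustees {V : Type*} [Fintype V] [DecidableEq V] (q : ℝ) (i : V)
    (y : Finset (V × V) → V → ℝ) :
    randomSubsetMean q (Finset.univ : Finset V).offDiag
        (fun E => (∑ j ∈ trustees E i, y (dropRows {i} E) j) / (trustees E i).card) =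
      (1 - (1 - q) ^ (Fintype.card V - 1)) / ((Fintype.card V - 1 : ℕ) : ℝ) *
        ∑ j ∈ Finset.univ.erase i,
          randomSubsetMean q (Finset.univ : Finset V).offDiag (fun E => y (dropRows {i} E) j) := by
  set A : Finset (V × V) := (Finset.univ.erase i).image fun j => (i, j) with hA
  set B : Finset (V × V) := dropRows {i} (Finset.univ : Finset V).offDiag with hB
  have hinj : Function.Injective fun j : V => (i, j) := fun a c h => (Prod.mk.inj h).2
  have hAmem : ∀ e, e ∈ A ↔ e.1 = i ∧ e.2 ≠ i := by
    rintro ⟨a, c⟩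
    simp only [hA, Finset.mem_image, Finset.mem_erase, Finset.mem_univ, and_true, Prod.mk.injEq]
    constructor
    · rintro ⟨x, hx, rfl, rfl⟩
      exact ⟨rfl, hx⟩
    · rintro ⟨rfl, hx⟩
      exact ⟨c, hx, rfl, rfl⟩
  have hBmem : ∀ e, e ∈ B ↔ e.1 ≠ e.2 ∧ e.1 ≠ i := by
    intro e
    simp [hB, dropRows]
  have hdisj : Disjoint A B := by
    rw [Finset.disjoint_left]
    intro e h1 h2
    exact ((hBmem e).1 h2).2 ((hAmem e).1 h1).1
  have hunion : (Finset.univ : Finset V).offDiag = A ∪ B := by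
    ext e
    rw [Finset.mem_union, hAmem, hBmem]
    simp only [Finset.mem_offDiag, Finset.mem_univ, true_and]
    grind
  have hdrop : ∀ F ⊆ A, ∀ G ⊆ B, dropRows {i} (F ∪ G) = G := by
    intro F hF G hG
    ext e
    simp only [dropRows, Finset.mem_filter, Finset.mem_union, Finset.mem_singleton]
    have h1 := fun h => (hAmem e).1 (@hF e h)
    have h2 := fun h => (hBmem e).1 (@hG e h)
    tauto
  have htr : ∀ F ⊆ A, ∀ G ⊆ B, (trustees (F ∪ G) i).image (fun j => (i, j)) = F := by
    intro F hF G hG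
    ext e
    simp only [trustees, Finset.mem_image, Finset.mem_filter, Finset.mem_univ, true_and,
      Finset.mem_union]
    constructor
    · rintro ⟨j, hj | hj, rfl⟩
      · exact hj
      · exact absurd rfl ((hBmem _).1 (hG hj)).2
    · intro he
      have h1 := ((hAmem e).1 (hF he)).1
      refine ⟨e.2, Or.inl ?_, ?_⟩ <;> rw [← h1]
      exact he
  have hcard : A.card = Fintype.card V - 1 := by
    rw [hA, Finset.card_image_of_injective _ hinj, Finset.card_erase_of_mem (Finset.mem_univ i),
      Finset.card_univ]
  have hR : ∀ j, randomSubsetMean q (A ∪ B) (fun E => y (dropRows {i} E) j) =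
      randomSubsetMean q B (fun G => y G j) := by
    intro j
    rw [randomSubsetMean_union q hdisj, ← randomSubsetMean_const q
      (randomSubsetMean q B (fun G => y G j)) A]
    exact randomSubsetMean_congr q fun F hF => randomSubsetMean_congr q fun G hG => by
      rw [hdrop F hF G hG]
  have hL : randomSubsetMean q (A ∪ B)
        (fun E => (∑ j ∈ trustees E i, y (dropRows {i} E) j) / (trustees E i).card) =
      randomSubsetMean q A
        (fun F => (∑ e ∈ F, randomSubsetMean q B (fun G => y G e.2)) / F.card) := by
    rw [randomSubsetMean_union q hdisj]
    refine randomSubsetMean_congr q fun F hF => ?_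
    rw [← randomSubsetMean_sum, div_eq_inv_mul, ← randomSubsetMean_const_mul]
    refine randomSubsetMean_congr q fun G hG => ?_
    rw [hdrop F hF G hG]
    nth_rw 3 4 [← htr F hF G hG]
    rw [Finset.sum_image fun a _ c _ h => hinj h, Finset.card_image_of_injective _ hinj,
      div_eq_inv_mul]
  rw [hunion, hL, randomSubsetMean_average, hcard, hA, Finset.sum_image fun a _ c _ h => hinj h,
    ← hA]
  congr 1
  exact Finset.sum_congr rfl fun j _ => (hR j).symm

/-! ### Expected scores in the random graph -/

/-- Approximate expected score of a non-rater, obtained by following the recommendations for `l`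
steps. Here `x` is the number of raters, `n` the number of other users than the one considered,
`θ` the discounted probability that a user trusts somebody, and `s` the number of users met
already, whose score is replaced by `v`, as are the scores beyond step `l`. The choice `v = 0` gives
a lower bound of the expected score, `v = r` an upper bound. -/
noncomputable def exploredScore (θ r n x v : ℝ) : ℕ → ℕ → ℝ
  | 0, _ => v
  | l + 1, s => θ * (x * r + s * v + (n - x - s) * exploredScore θ r n x v l (s + 1)) / n

section Explore

variable {V : Type*} [Fintype V] [DecidableEq V] {t r q : ℝ}

/-- Users met earlier are turned into raters: this only raises scores, and makes the score of the
users trusted by `i` independent of whom `i` trusts. -/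
theorem randomSubsetMean_score_le (ht0 : 0 < t) (ht1 : t ≤ 1) (hr : 0 < r) (hq0 : 0 ≤ q)
    (hq1 : q ≤ 1) (m l : ℕ) : ∀ (s : ℕ) (R : Finset V), R.card = m + s → ∀ i ∉ R,
    randomSubsetMean q (Finset.univ : Finset V).offDiag
        (fun E => score (1 / 2) E (fun _ _ => t) R (fun _ => r) i) ≤
      exploredScore (t * (1 - (1 - q) ^ (Fintype.card V - 1))) r
        ((Fintype.card V - 1 : ℕ) : ℝ) m r l s := by
  have hh0 : (0 : ℝ) < 1 / 2 := by norm_num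
  have hh1 : (1 / 2 : ℝ) < 1 := by norm_num
  induction l with
  | zero =>
    intro s R _ i _
    refine (randomSubsetMean_mono hq0 hq1 fun E _ => ?_).trans_eq (randomSubsetMean_const q r _)
    exact score_le hh0 hh1 ht0 ht1 E R hr i
  | succ l ih =>
    intro s R hR i hi
    set g := exploredScore (t * (1 - (1 - q) ^ (Fintype.card V - 1))) r
        ((Fintype.card V - 1 : ℕ) : ℝ) m r l (s + 1) with hg
    let y : Finset (V × V) → V → ℝ :=
      fun G j => score (1 / 2) G (fun _ _ => t) (R ∪ {i}) (fun _ => r) j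
    have hp : 0 ≤ 1 - (1 - q) ^ (Fintype.card V - 1) :=
      sub_nonneg.2 (pow_le_one₀ (by linarith) (by linarith))
    have h1 : randomSubsetMean q (Finset.univ : Finset V).offDiag
        (fun E => score (1 / 2) E (fun _ _ => t) R (fun _ => r) i) ≤
        randomSubsetMean q (Finset.univ : Finset V).offDiag (fun E => t *
          ((∑ j ∈ trustees E i, y (dropRows {i} E) j) / (trustees E i).card)) := by
      refine randomSubsetMean_mono hq0 hq1 fun E _ => ?_
      rw [score_half_nonRater ht0 ht1 E R hi]
      refine mul_le_mul_of_nonneg_left (div_le_div_of_nonneg_right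
        (Finset.sum_le_sum fun j _ => ?_) (Nat.cast_nonneg _)) ht0.le
      exact score_le_dropRows_union ht0 ht1 hr E R {i} j
    rw [randomSubsetMean_const_mul, randomSubsetMean_trustees] at h1
    have hsub : R ⊆ Finset.univ.erase i := fun j hj =>
      Finset.mem_erase.2 ⟨fun h => hi (h ▸ hj), Finset.mem_univ j⟩
    have hcard : (((Finset.univ.erase i) \ R).card : ℝ) =
        ((Fintype.card V - 1 : ℕ) : ℝ) - m - s := by
      rw [Finset.cast_card_sdiff hsub, hR, Finset.card_erase_of_mem (Finset.mem_univ i),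
        Finset.card_univ]
      push_cast
      ring
    have h2 : ∑ j ∈ Finset.univ.erase i, randomSubsetMean q (Finset.univ : Finset V).offDiag
          (fun E => y (dropRows {i} E) j) ≤
        m * r + s * r + (((Fintype.card V - 1 : ℕ) : ℝ) - m - s) * g := by
      rw [← Finset.sum_sdiff hsub, ← hcard, add_comm]
      refine add_le_add ?_ ?_
      · refine (Finset.sum_le_card_nsmul _ _ r fun j _ => ?_).trans_eq ?_
        · refine (randomSubsetMean_mono hq0 hq1 fun E _ => ?_).trans_eq
            (randomSubsetMean_const q r _)
          exact score_le hh0 hh1 ht0 ht1 _ _ hr j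
        · rw [hR, nsmul_eq_mul]
          push_cast
          ring
      · rw [← nsmul_eq_mul]
        refine Finset.sum_le_card_nsmul _ _ g fun j hj => ?_
        obtain ⟨hj1, hj2⟩ := Finset.mem_sdiff.1 hj
        refine (randomSubsetMean_mono hq0 hq1 fun E _ =>
          score_dropRows_le ht0 ht1 hr E (R ∪ {i}) {i} j).trans ?_
        refine ih (s + 1) (R ∪ {i}) ?_ j ?_
        · rw [Finset.union_comm, ← Finset.insert_eq, Finset.card_insert_of_notMem hi, hR, add_assoc]
        · simp [hj2, Finset.ne_of_mem_erase hj1]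
    refine h1.trans ?_
    rw [exploredScore, ← hg, mul_div_assoc, mul_assoc]
    refine mul_le_mul_of_nonneg_left ?_ ht0.le
    rw [div_mul_eq_mul_div, mul_div_assoc]
    exact mul_le_mul_of_nonneg_left
      (div_le_div_of_nonneg_right h2 (Nat.cast_nonneg _)) hp

/-- Users met earlier, the set `S`, no longer trust anybody: this only lowers scores, and makes the
score of the users trusted by `i` independent of whom `i` trusts. -/
theorem le_randomSubsetMean_score (ht0 : 0 < t) (ht1 : t ≤ 1) (hr : 0 < r) (hq0 : 0 ≤ q)
    (hq1 : q ≤ 1) (R : Finset V) (l : ℕ) : ∀ S : Finset V, Disjoint R S → ∀ i ∉ R, i ∉ S →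
    exploredScore (t * (1 - (1 - q) ^ (Fintype.card V - 1))) r
        ((Fintype.card V - 1 : ℕ) : ℝ) R.card 0 l S.card ≤
      randomSubsetMean q (Finset.univ : Finset V).offDiag
        (fun E => score (1 / 2) (dropRows S E) (fun _ _ => t) R (fun _ => r) i) := by
  have hh0 : (0 : ℝ) < 1 / 2 := by norm_num
  have hh1 : (1 / 2 : ℝ) < 1 := by norm_num
  induction l with
  | zero =>
    intro S _ i _ _
    refine (randomSubsetMean_const q 0 _).symm.trans_le
      (randomSubsetMean_mono hq0 hq1 fun E _ => ?_)
    exact score_nonneg hh0 hh1 ht0 ht1 _ R hr i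
  | succ l ih =>
    intro S hS i hi hiS
    set g := exploredScore (t * (1 - (1 - q) ^ (Fintype.card V - 1))) r
        ((Fintype.card V - 1 : ℕ) : ℝ) R.card 0 l (S.card + 1) with hg
    let y : Finset (V × V) → V → ℝ :=
      fun G j => score (1 / 2) (dropRows S G) (fun _ _ => t) R (fun _ => r) j
    have hp : 0 ≤ 1 - (1 - q) ^ (Fintype.card V - 1) :=
      sub_nonneg.2 (pow_le_one₀ (by linarith) (by linarith))
    have hcomm : ∀ E, dropRows S (dropRows {i} E) = dropRows {i} (dropRows S E) :=
      fun E => Finset.filter_comm _ _ _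
    have h1 : randomSubsetMean q (Finset.univ : Finset V).offDiag (fun E => t *
          ((∑ j ∈ trustees E i, y (dropRows {i} E) j) / (trustees E i).card)) ≤
        randomSubsetMean q (Finset.univ : Finset V).offDiag
          (fun E => score (1 / 2) (dropRows S E) (fun _ _ => t) R (fun _ => r) i) := by
      refine randomSubsetMean_mono hq0 hq1 fun E _ => ?_
      rw [score_half_nonRater ht0 ht1 _ R hi, trustees_dropRows E hiS]
      refine mul_le_mul_of_nonneg_left (div_le_div_of_nonneg_right
        (Finset.sum_le_sum fun j _ => ?_) (Nat.cast_nonneg _)) ht0.le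
      simp only [y, hcomm]
      exact score_dropRows_le ht0 ht1 hr (dropRows S E) R {i} j
    rw [randomSubsetMean_const_mul, randomSubsetMean_trustees] at h1
    have hsub : R ∪ S ⊆ Finset.univ.erase i := fun j hj =>
      Finset.mem_erase.2 ⟨fun h => (Finset.mem_union.1 (h ▸ hj)).elim hi hiS, Finset.mem_univ j⟩
    have hcard : (((Finset.univ.erase i) \ (R ∪ S)).card : ℝ) =
        ((Fintype.card V - 1 : ℕ) : ℝ) - R.card - S.card := by
      rw [Finset.cast_card_sdiff hsub, Finset.card_union_of_disjoint hS,
        Finset.card_erase_of_mem (Finset.mem_univ i), Finset.card_univ]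
      push_cast
      ring
    have h2 : R.card * r + S.card * 0 +
          (((Fintype.card V - 1 : ℕ) : ℝ) - R.card - S.card) * g ≤
        ∑ j ∈ Finset.univ.erase i, randomSubsetMean q (Finset.univ : Finset V).offDiag
          (fun E => y (dropRows {i} E) j) := by
      rw [← Finset.sum_sdiff hsub, ← hcard, add_comm, Finset.sum_union hS]
      refine add_le_add ?_ (add_le_add ?_ ?_)
      · rw [← nsmul_eq_mul]
        refine Finset.card_nsmul_le_sum _ _ g fun j hj => ?_
        obtain ⟨hj1, hj2⟩ := Finset.mem_sdiff.1 hj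
        simp only [y, hcomm, ← dropRows_insert]
        rw [hg, ← Finset.card_insert_of_notMem hiS]
        refine ih (insert i S) ?_ j (fun h => hj2 (Finset.mem_union_left _ h)) ?_
        · exact Finset.disjoint_insert_right.2 ⟨hi, hS⟩
        · simp only [Finset.mem_insert, not_or]
          exact ⟨Finset.ne_of_mem_erase hj1, fun h => hj2 (Finset.mem_union_right _ h)⟩
      · rw [← nsmul_eq_mul]
        refine Finset.card_nsmul_le_sum _ _ r fun j hj => ?_
        refine (randomSubsetMean_const q r _).symm.trans_le
          (randomSubsetMean_mono hq0 hq1 fun E _ => ?_)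
        exact (score_rater hh0 hh1 ht0 ht1 _ _ hj).ge
      · rw [mul_zero]
        refine Finset.sum_nonneg fun j _ => (randomSubsetMean_const q 0 _).symm.trans_le
          (randomSubsetMean_mono hq0 hq1 fun E _ => ?_)
        exact score_nonneg hh0 hh1 ht0 ht1 _ _ hr j
    refine le_trans ?_ h1
    rw [exploredScore, ← hg, mul_div_assoc, mul_assoc]
    refine mul_le_mul_of_nonneg_left ?_ ht0.le
    rw [div_mul_eq_mul_div, mul_div_assoc]
    exact mul_le_mul_of_nonneg_left
      (div_le_div_of_nonneg_right h2 (Nat.cast_nonneg _)) hp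

end Explore

/-! ### The mean-field limit -/

/-- Limit of the expected score of a non-rater when a proportion `k` of the users are raters and
`θ` is the discounted probability of trusting somebody: the fixed point of
`x ↦ θ * (k * r + (1 - k) * x)`. -/
noncomputable def limitScore (θ r k : ℝ) : ℝ := θ * k * r / (1 - θ * (1 - k))

theorem tendsto_exploredScore {θ : ℕ → ℝ} {x n : ℕ → ℝ} {θ' k r v : ℝ}
    (hθ : Filter.Tendsto θ Filter.atTop (nhds θ')) (hn : Filter.Tendsto n Filter.atTop Filter.atTop)
    (hx : Filter.Tendsto (fun N => x N / n N) Filter.atTop (nhds k))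
    (hk : 1 - θ' * (1 - k) ≠ 0) (l : ℕ) : ∀ s : ℕ,
    Filter.Tendsto (fun N => exploredScore (θ N) r (n N) (x N) v l s) Filter.atTop
      (nhds (limitScore θ' r k + (θ' * (1 - k)) ^ l * (v - limitScore θ' r k))) := by
  induction l with
  | zero => intro s; simp [exploredScore]
  | succ l ih =>
    intro s
    have hs : Filter.Tendsto (fun N => (s : ℝ) / n N) Filter.atTop (nhds 0) :=
      tendsto_const_nhds.div_atTop hn
    have h1 := hθ.mul (((hx.mul_const r).add (hs.mul_const v)).add
      (((tendsto_const_nhds (x := (1 : ℝ))).sub hx |>.sub hs).mul (ih (s + 1))))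
    have hfix : limitScore θ' r k = θ' * (k * r + (1 - k) * limitScore θ' r k) := by
      unfold limitScore
      field_simp
      ring
    have hlim : θ' * (k * r + 0 * v + (1 - k - 0) * (limitScore θ' r k +
        (θ' * (1 - k)) ^ l * (v - limitScore θ' r k))) =
        limitScore θ' r k + (θ' * (1 - k)) ^ (l + 1) * (v - limitScore θ' r k) := by
      rw [pow_succ]
      linear_combination -hfix
    rw [hlim] at h1
    refine h1.congr' ?_
    filter_upwards [hn.eventually_gt_atTop 0] with N hN
    rw [exploredScore]
    field_simp

theorem tendsto_prob_trusting {lam : ℝ} :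
    Filter.Tendsto (fun N : ℕ => 1 - (1 - min (lam / N) 1) ^ (N - 1)) Filter.atTop
      (nhds (1 - Real.exp (-lam))) := by
  refine tendsto_const_nhds.sub ?_
  have h0 : Filter.Tendsto (fun N : ℕ => 1 + -lam / (N : ℝ)) Filter.atTop (nhds 1) := by
    simpa using (tendsto_const_nhds (x := (1 : ℝ))).add
      (tendsto_const_div_atTop_nhds_zero_nat (-lam))
  have h1 := (Real.tendsto_one_add_div_pow_exp (-lam)).div h0 one_ne_zero
  rw [div_one] at h1
  refine h1.congr' ?_
  filter_upwards [h0.eventually_ne one_ne_zero, Filter.eventually_gt_atTop 0,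
    (tendsto_const_div_atTop_nhds_zero_nat lam).eventually_lt_const one_pos] with N hN hN0 hN1
  obtain ⟨n, rfl⟩ := Nat.exists_eq_add_of_lt hN0
  rw [min_eq_left hN1.le, Pi.div_apply, zero_add, pow_succ, Nat.add_sub_cancel]
  rw [zero_add] at hN
  rw [mul_div_cancel_right₀ _ hN, neg_div, ← sub_eq_add_neg]

/-! ### The expected number of unsatisfied users -/

theorem expectation_eq (N : ℕ) (lam : ℝ) (m : ℕ)
    (f : Finset (Fin N × Fin N) → Finset (Fin N) → ℝ) :
    expectation N lam m f = ((N.choose m : ℝ))⁻¹ *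
      ∑ R ∈ Finset.powersetCard m (Finset.univ : Finset (Fin N)),
        randomSubsetMean (min (lam / N) 1) (Finset.univ : Finset (Fin N)).offDiag
          (fun E => f E R) := by
  unfold expectation randomSubsetMean
  rw [Finset.sum_comm, Finset.mul_sum]
  refine Finset.sum_congr rfl fun R _ => ?_
  rw [Finset.mul_sum]
  refine Finset.sum_congr rfl fun E _ => ?_
  have hc : (Finset.univ : Finset (Fin N)).offDiag.card = N * (N - 1) := by
    rw [Finset.offDiag_card, Finset.card_univ, Fintype.card_fin, Nat.mul_sub_one]
  rw [hc]
  ring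

theorem expectation_congr {N : ℕ} (lam : ℝ) {m : ℕ}
    {f g : Finset (Fin N × Fin N) → Finset (Fin N) → ℝ}
    (h : ∀ E R, R.card = m → f E R = g E R) : expectation N lam m f = expectation N lam m g := by
  rw [expectation_eq, expectation_eq]
  congr 1
  refine Finset.sum_congr rfl fun R hR => randomSubsetMean_congr _ fun E _ => ?_
  exact h E R (Finset.mem_powersetCard.1 hR).2

theorem expectation_one_sub_mul {N : ℕ} (lam : ℝ) {m : ℕ} (hm : m ≤ N) (c : ℝ)
    (f : Finset (Fin N × Fin N) → Finset (Fin N) → ℝ) :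
    expectation N lam m (fun E R => 1 - c * f E R) = 1 - c * expectation N lam m f := by
  have hc : (N.choose m : ℝ) ≠ 0 := by exact_mod_cast (Nat.choose_pos hm).ne'
  rw [expectation_eq, expectation_eq,
    Finset.sum_congr rfl fun R _ => randomSubsetMean_const_sub_mul _ 1 c _ fun E => f E R,
    Finset.sum_sub_distrib, ← Finset.mul_sum, Finset.sum_const, Finset.card_powersetCard,
    Finset.card_univ, Fintype.card_fin, nsmul_eq_mul, mul_one, mul_sub, inv_mul_cancel₀ hc]
  ring

theorem expectation_le {N : ℕ} (lam : ℝ) {m : ℕ} (hm : m ≤ N) {c : ℝ}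
    {f : Finset (Fin N × Fin N) → Finset (Fin N) → ℝ}
    (h : ∀ R : Finset (Fin N), R.card = m → randomSubsetMean (min (lam / N) 1)
      (Finset.univ : Finset (Fin N)).offDiag (fun E => f E R) ≤ c) :
    expectation N lam m f ≤ c := by
  have hc : (0 : ℝ) < N.choose m := by exact_mod_cast Nat.choose_pos hm
  rw [expectation_eq, inv_mul_le_iff₀ hc]
  refine (Finset.sum_le_card_nsmul _ _ c fun R hR =>
    h R (Finset.mem_powersetCard.1 hR).2).trans_eq ?_
  rw [Finset.card_powersetCard, Finset.card_univ, Fintype.card_fin, nsmul_eq_mul]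

theorem le_expectation {N : ℕ} (lam : ℝ) {m : ℕ} (hm : m ≤ N) {c : ℝ}
    {f : Finset (Fin N × Fin N) → Finset (Fin N) → ℝ}
    (h : ∀ R : Finset (Fin N), R.card = m → c ≤ randomSubsetMean (min (lam / N) 1)
      (Finset.univ : Finset (Fin N)).offDiag (fun E => f E R)) :
    c ≤ expectation N lam m f := by
  have hc : (0 : ℝ) < N.choose m := by exact_mod_cast Nat.choose_pos hm
  rw [expectation_eq, le_inv_mul_iff₀ hc]
  refine Eq.trans_le ?_ (Finset.card_nsmul_le_sum _ _ c fun R hR =>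
    h R (Finset.mem_powersetCard.1 hR).2)
  rw [Finset.card_powersetCard, Finset.card_univ, Fintype.card_fin, nsmul_eq_mul]

/-- Expected number of non-raters that are not satisfied. -/
noncomputable def expectedUnsatisfied (α lam t r b : ℝ) (N m : ℕ) : ℝ :=
  expectation N lam m fun E R =>
    ((Rᶜ.filter fun i => score α E (fun _ _ => t) R (fun _ => r) i ≤ b).card : ℝ)

/-- If everybody is a rater, this holds because `0⁻¹ = 0`. -/
theorem nonRaterSatisfaction_eq (α lam t r b : ℝ) {N m : ℕ} (hm : m ≤ N) :
    nonRaterSatisfaction α lam t r b N m =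
      1 - ((N : ℝ) - m)⁻¹ * expectedUnsatisfied α lam t r b N m := by
  rw [expectedUnsatisfied, ← expectation_one_sub_mul lam hm]
  refine expectation_congr lam fun E R hR => ?_
  rw [satisfiedProportion, div_eq_inv_mul, Finset.card_compl, hR, Fintype.card_fin,
    Nat.cast_sub hm]

/-- Raters are satisfied because `b < r`, so only non-raters can be unsatisfied. -/
theorem communitySatisfaction_eq {α t r b : ℝ} (h0 : 0 < α) (h1 : α < 1) (ht0 : 0 < t)
    (ht1 : t ≤ 1) (hbr : b < r) (lam : ℝ) {N m : ℕ} (hm : m ≤ N) :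
    communitySatisfaction α lam t r b N m =
      1 - (N : ℝ)⁻¹ * expectedUnsatisfied α lam t r b N m := by
  rw [expectedUnsatisfied, ← expectation_one_sub_mul lam hm]
  refine expectation_congr lam fun E R hR => ?_
  rw [satisfiedProportion, div_eq_inv_mul, Finset.card_univ, Fintype.card_fin]
  congr 4
  ext i
  simp only [Finset.mem_filter, Finset.mem_univ, true_and, Finset.mem_compl]
  refine ⟨fun h => ⟨fun hi => ?_, h⟩, fun h => h.2⟩
  rw [score_rater h0 h1 ht0 ht1 E R hi] at h
  linarith

section Markov

variable {α t r b lam : ℝ} (ht0 : 0 < t) (ht1 : t ≤ 1) (hr : 0 < r) (hlam : 0 < lam)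

include ht0 ht1 hr hlam

/-- Markov's inequality: the expected score of a non-rater bounds the probability that he is
satisfied from above. -/
theorem le_expectedUnsatisfied (hb0 : 0 < b) {N m : ℕ} (hm : m ≤ N) (l : ℕ) :
    ((N : ℝ) - m) * (1 - b⁻¹ * exploredScore (t * (1 - (1 - min (lam / N) 1) ^ (N - 1))) r
        ((N - 1 : ℕ) : ℝ) m r l 0) ≤ expectedUnsatisfied (1 / 2) lam t r b N m := by
  have hh0 : (0 : ℝ) < 1 / 2 := by norm_num
  have hh1 : (1 / 2 : ℝ) < 1 := by norm_num
  have hq0 : 0 ≤ min (lam / N) 1 := le_min (by positivity) zero_le_one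
  have hq1 : min (lam / N) 1 ≤ 1 := min_le_right _ _
  refine le_expectation lam hm fun R hR => ?_
  simp only [Finset.card_filter, Nat.cast_sum, Nat.cast_ite, Nat.cast_one, Nat.cast_zero]
  have hcard : Rᶜ.card = N - R.card := by rw [Finset.card_compl, Fintype.card_fin]
  rw [randomSubsetMean_sum, ← Nat.cast_sub hm, ← hR, ← hcard, ← nsmul_eq_mul]
  refine Finset.card_nsmul_le_sum _ _ _ fun i hi => ?_
  have h1 := randomSubsetMean_score_le ht0 ht1 hr hq0 hq1 R.card l 0 R (add_zero _).symm i
      (Finset.mem_compl.1 hi)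
  rw [Fintype.card_fin] at h1
  refine (sub_le_sub_left (mul_le_mul_of_nonneg_left h1 (inv_nonneg.2 hb0.le)) 1).trans ?_
  rw [← randomSubsetMean_const_sub_mul]
  refine randomSubsetMean_mono hq0 hq1 fun E _ => ?_
  have hs := score_nonneg hh0 hh1 ht0 ht1 E R hr i
  split_ifs with h
  · linarith [mul_nonneg (inv_nonneg.2 hb0.le) hs]
  · push Not at h
    rw [sub_nonpos, ← div_eq_inv_mul, one_le_div hb0]
    exact h.le

/-- Markov's inequality for one minus the score. Scores for `α = 1 / 2` are enough, since the
scores for larger `α` are not smaller. -/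
theorem expectedUnsatisfied_le (hr1 : r ≤ 1) (hbr : b < r) (hα : 1 / 2 ≤ α) (hα1 : α < 1)
    {N m : ℕ} (hm : m ≤ N) (l : ℕ) :
    expectedUnsatisfied α lam t r b N m ≤ ((N : ℝ) - m) * ((1 - b)⁻¹ *
      (1 - exploredScore (t * (1 - (1 - min (lam / N) 1) ^ (N - 1))) r
        ((N - 1 : ℕ) : ℝ) m 0 l 0)) := by
  have hh0 : (0 : ℝ) < 1 / 2 := by norm_num
  have hh1 : (1 / 2 : ℝ) < 1 := by norm_num
  have hq0 : 0 ≤ min (lam / N) 1 := le_min (by positivity) zero_le_one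
  have hq1 : min (lam / N) 1 ≤ 1 := min_le_right _ _
  have hb : 0 < 1 - b := by linarith
  refine expectation_le lam hm fun R hR => ?_
  simp only [Finset.card_filter, Nat.cast_sum, Nat.cast_ite, Nat.cast_one, Nat.cast_zero]
  have hcard : Rᶜ.card = N - R.card := by rw [Finset.card_compl, Fintype.card_fin]
  rw [randomSubsetMean_sum, ← Nat.cast_sub hm, ← hR, ← hcard, ← nsmul_eq_mul]
  refine Finset.sum_le_card_nsmul _ _ _ fun i hi => ?_
  have h1 := le_randomSubsetMean_score ht0 ht1 hr hq0 hq1 R l ∅ (Finset.disjoint_empty_right R) i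
      (Finset.mem_compl.1 hi) (Finset.notMem_empty i)
  have hempty : ∀ E : Finset (Fin N × Fin N), dropRows ∅ E = E := fun E => by simp [dropRows]
  simp only [Fintype.card_fin, hempty, Finset.card_empty] at h1
  refine le_trans ?_ (mul_le_mul_of_nonneg_left (sub_le_sub_left h1 1) (inv_nonneg.2 hb.le))
  rw [mul_sub, mul_one, ← randomSubsetMean_const_sub_mul]
  refine randomSubsetMean_mono hq0 hq1 fun E _ => ?_
  have hs := score_le hh0 hh1 ht0 ht1 E R hr i
  have hle := score_half_le ht0 ht1 hr E R hα hα1 i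
  rw [← mul_one_sub]
  split_ifs with h
  · rw [← div_eq_inv_mul, one_le_div hb]
    linarith
  · exact mul_nonneg (inv_nonneg.2 hb.le) (by linarith)

end Markov

section Asymptotics

variable {α t r b lam k : ℝ} {m : ℕ → ℕ}

theorem discounted_prob_mem {t lam : ℝ} (hlam : 0 < lam) (ht0 : 0 < t) (ht1 : t ≤ 1) :
    0 < t * (1 - Real.exp (-lam)) ∧ t * (1 - Real.exp (-lam)) < 1 := by
  have h1 : Real.exp (-lam) < 1 := Real.exp_lt_one_iff.2 (by linarith)
  have h2 := Real.exp_pos (-lam)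
  exact ⟨mul_pos ht0 (by linarith), by nlinarith⟩

theorem proportion_mem_Icc (hm : ∀ N, m N ≤ N)
    (hk : Filter.Tendsto (fun N : ℕ => (m N : ℝ) / (N : ℝ)) Filter.atTop (nhds k)) :
    k ∈ Set.Icc (0 : ℝ) 1 := by
  refine isClosed_Icc.mem_of_tendsto hk (Filter.Eventually.of_forall fun N => ⟨by positivity, ?_⟩)
  exact div_le_one_of_le₀ (by exact_mod_cast hm N) (Nat.cast_nonneg _)

/-- The bounds of the expected scores come arbitrarily close to the mean-field limit. -/
theorem exists_tendsto_exploredScore (hlam : 0 < lam) (ht0 : 0 < t) (ht1 : t ≤ 1)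
    (hm : ∀ N, m N ≤ N)
    (hk : Filter.Tendsto (fun N : ℕ => (m N : ℝ) / (N : ℝ)) Filter.atTop (nhds k))
    (r v : ℝ) {ε : ℝ} (hε : 0 < ε) :
    ∃ l, ∀ᶠ N : ℕ in Filter.atTop,
      |exploredScore (t * (1 - (1 - min (lam / N) 1) ^ (N - 1))) r ((N - 1 : ℕ) : ℝ) (m N) v l 0 -
        limitScore (t * (1 - Real.exp (-lam))) r k| < ε := by
  obtain ⟨hθ0, hθ1⟩ := discounted_prob_mem hlam ht0 ht1
  obtain ⟨hk0, hk1⟩ := proportion_mem_Icc hm hk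
  set θ := t * (1 - Real.exp (-lam)) with hθ
  have hc0 : 0 ≤ θ * (1 - k) := mul_nonneg hθ0.le (by linarith)
  have hc1 : θ * (1 - k) < 1 := by nlinarith
  have hn : Filter.Tendsto (fun N : ℕ => ((N - 1 : ℕ) : ℝ)) Filter.atTop Filter.atTop :=
    tendsto_natCast_atTop_atTop.comp (Filter.tendsto_sub_atTop_nat 1)
  have hx : Filter.Tendsto (fun N : ℕ => (m N : ℝ) / ((N - 1 : ℕ) : ℝ)) Filter.atTop (nhds k) := by
    have h1 : Filter.Tendsto (fun N : ℕ => 1 + 1 / ((N - 1 : ℕ) : ℝ)) Filter.atTop (nhds 1) := by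
      simpa using (tendsto_const_nhds (x := (1 : ℝ))).add
        ((tendsto_const_nhds (x := (1 : ℝ))).div_atTop hn)
    have h2 := hk.mul h1
    rw [mul_one] at h2
    refine h2.congr' ?_
    filter_upwards [Filter.eventually_gt_atTop 1] with N hN
    have hN1 : (1 : ℝ) < N := by exact_mod_cast hN
    rw [Nat.cast_sub hN.le, Nat.cast_one]
    have : (N : ℝ) - 1 ≠ 0 := by linarith
    have : (N : ℝ) ≠ 0 := by linarith
    field_simp
    ring
  have hlim := fun l => tendsto_exploredScore (r := r) (v := v)
    ((tendsto_prob_trusting (lam := lam)).const_mul t) hn hx (by rw [← hθ]; linarith) l 0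
  have hl : Filter.Tendsto (fun l : ℕ => limitScore θ r k +
      (θ * (1 - k)) ^ l * (v - limitScore θ r k)) Filter.atTop (nhds (limitScore θ r k)) := by
    simpa using ((tendsto_pow_atTop_nhds_zero_of_lt_one hc0 hc1).mul_const
      (v - limitScore θ r k)).const_add (limitScore θ r k)
  obtain ⟨l, hl⟩ := ((Metric.tendsto_nhds.1 hl) ε hε).exists
  rw [dist_comm, Real.dist_eq] at hl
  refine ⟨l, ?_⟩
  have := ((hlim l).sub_const (limitScore θ r k)).abs
  refine this.eventually_lt_const ?_
  rw [← hθ]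
  rwa [abs_sub_comm] at hl

/-- Asymptotically, at most a proportion `limitScore / b` of the non-raters is satisfied. -/
theorem eventually_le_expectedUnsatisfied (hlam : 0 < lam) (ht0 : 0 < t) (ht1 : t ≤ 1)
    (hr : 0 < r) (hb0 : 0 < b) (hm : ∀ N, m N ≤ N)
    (hk : Filter.Tendsto (fun N : ℕ => (m N : ℝ) / (N : ℝ)) Filter.atTop (nhds k))
    {x : ℝ} (hx : x < 1 - limitScore (t * (1 - Real.exp (-lam))) r k / b) :
    ∀ᶠ N : ℕ in Filter.atTop, ((N : ℝ) - m N) * x ≤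
      expectedUnsatisfied (1 / 2) lam t r b N (m N) := by
  set z := limitScore (t * (1 - Real.exp (-lam))) r k with hz
  have hε : 0 < b * (1 - x) - z := by
    have : z / b < 1 - x := by linarith
    rw [div_lt_iff₀ hb0] at this
    linarith
  obtain ⟨l, hl⟩ := exists_tendsto_exploredScore hlam ht0 ht1 hm hk r r hε
  filter_upwards [hl] with N hN
  have hmN : (0 : ℝ) ≤ (N : ℝ) - m N := sub_nonneg.2 (by exact_mod_cast hm N)
  refine le_trans (mul_le_mul_of_nonneg_left ?_ hmN)
    (le_expectedUnsatisfied ht0 ht1 hr hlam hb0 (hm N) l)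
  have h1 := (abs_lt.1 hN).2
  rw [le_sub_comm, inv_mul_le_iff₀ hb0]
  linarith

/-- Asymptotically, at least a proportion `(limitScore - b) / (1 - b)` of the non-raters is
satisfied. -/
theorem eventually_expectedUnsatisfied_le (hlam : 0 < lam) (ht0 : 0 < t) (ht1 : t ≤ 1)
    (hr : 0 < r) (hr1 : r ≤ 1) (hbr : b < r) (hα : 1 / 2 ≤ α) (hα1 : α < 1)
    (hm : ∀ N, m N ≤ N)
    (hk : Filter.Tendsto (fun N : ℕ => (m N : ℝ) / (N : ℝ)) Filter.atTop (nhds k))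
    {x : ℝ} (hx : (1 - limitScore (t * (1 - Real.exp (-lam))) r k) / (1 - b) < x) :
    ∀ᶠ N : ℕ in Filter.atTop, expectedUnsatisfied α lam t r b N (m N) ≤
      ((N : ℝ) - m N) * x := by
  set z := limitScore (t * (1 - Real.exp (-lam))) r k with hz
  have hb : 0 < 1 - b := by linarith
  have hε : 0 < (1 - b) * x - (1 - z) := by
    rw [div_lt_iff₀ hb] at hx
    linarith
  obtain ⟨l, hl⟩ := exists_tendsto_exploredScore hlam ht0 ht1 hm hk r 0 hε
  filter_upwards [hl] with N hN
  have hmN : (0 : ℝ) ≤ (N : ℝ) - m N := sub_nonneg.2 (by exact_mod_cast hm N)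
  refine (expectedUnsatisfied_le ht0 ht1 hr hlam hr1 hbr hα hα1 (hm N) l).trans
    (mul_le_mul_of_nonneg_left ?_ hmN)
  have h1 := (abs_lt.1 hN).1
  rw [inv_mul_le_iff₀ hb]
  linarith

end Asymptotics

theorem expectedUnsatisfied_mem_Icc (α t r b : ℝ) {lam : ℝ} (hlam : 0 < lam) {N m : ℕ}
    (hm : m ≤ N) : expectedUnsatisfied α lam t r b N m ∈ Set.Icc (0 : ℝ) ((N : ℝ) - m) := by
  have hq0 : 0 ≤ min (lam / N) 1 := le_min (by positivity) zero_le_one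
  have hq1 : min (lam / N) 1 ≤ 1 := min_le_right _ _
  constructor
  · exact le_expectation lam hm fun R hR => (randomSubsetMean_const _ 0 _).symm.trans_le
      (randomSubsetMean_mono hq0 hq1 fun E _ => Nat.cast_nonneg _)
  · refine expectation_le lam hm fun R hR => (randomSubsetMean_mono hq0 hq1 fun E _ => ?_).trans_eq
      (randomSubsetMean_const _ ((N : ℝ) - m) _)
    have hcard : Rᶜ.card = N - R.card := by rw [Finset.card_compl, Fintype.card_fin]
    rw [← Nat.cast_sub hm, ← hR, ← hcard]
    exact_mod_cast Finset.card_filter_le _ _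

theorem nonRaterSatisfaction_mem_Icc (α t r b : ℝ) {lam : ℝ} (hlam : 0 < lam) {N m : ℕ}
    (hm : m ≤ N) : nonRaterSatisfaction α lam t r b N m ∈ Set.Icc (0 : ℝ) 1 := by
  obtain ⟨h1, h2⟩ := expectedUnsatisfied_mem_Icc α t r b hlam hm
  have h0 : (0 : ℝ) ≤ (N : ℝ) - m := sub_nonneg.2 (by exact_mod_cast hm)
  rw [nonRaterSatisfaction_eq α lam t r b hm, ← div_eq_inv_mul]
  exact ⟨sub_nonneg.2 (div_le_one_of_le₀ h2 h0), sub_le_self _ (div_nonneg h1 h0)⟩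

theorem limsup_le_of_mem_Icc {f : ℕ → ℝ} (hf : ∀ N, f N ∈ Set.Icc (0 : ℝ) 1) {c : ℝ}
    (h : ∀ᶠ N in Filter.atTop, f N ≤ c) : Filter.limsup f Filter.atTop ≤ c :=
  Filter.limsup_le_of_le
    (Filter.isBoundedUnder_of ⟨0, fun N => (hf N).1⟩ :
      Filter.IsBoundedUnder (· ≥ ·) Filter.atTop f).isCoboundedUnder_le h

theorem le_liminf_of_mem_Icc {f : ℕ → ℝ} (hf : ∀ N, f N ∈ Set.Icc (0 : ℝ) 1) {c : ℝ}
    (h : ∀ᶠ N in Filter.atTop, c ≤ f N) : c ≤ Filter.liminf f Filter.atTop :=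
  Filter.le_liminf_of_le
    (Filter.isBoundedUnder_of ⟨1, fun N => (hf N).2⟩ :
      Filter.IsBoundedUnder (· ≤ ·) Filter.atTop f).isCoboundedUnder_ge h

/-! ### The bounds on the proportion of raters -/

section Bounds

variable {lam t r b k T : ℝ} (hlam : 0 < lam) (ht0 : 0 < t) (ht1 : t ≤ 1) (hbr : b < r)

theorem kMax_le_one : kMax lam t r b T ≤ 1 := by
  unfold kMax
  split_ifs
  · exact min_le_right _ _
  · exact le_rfl

include hlam ht0 ht1

theorem limitScore_denom_pos (hk0 : 0 ≤ k) : 0 < 1 - t * (1 - Real.exp (-lam)) * (1 - k) := by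
  obtain ⟨hθ0, hθ1⟩ := discounted_prob_mem hlam ht0 ht1
  nlinarith [mul_nonneg hθ0.le hk0]

/-- The fraction in `kMax` exceeds `1` once `b + T * (1 - b)` exceeds `θ * r`, the limit score when
almost everybody is a rater. -/
theorem kMax_eq_one (h : t * (1 - Real.exp (-lam)) * r ≤ T * (1 - b) + b) :
    kMax lam t r b T = 1 := by
  obtain ⟨hθ0, hθ1⟩ := discounted_prob_mem hlam ht0 ht1
  unfold kMax
  set θ := t * (1 - Real.exp (-lam))
  split_ifs with hc
  · rw [min_eq_right_iff, one_le_div (mul_pos hθ0 hc)]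
    linarith
  · rfl

theorem kMax_eq (hr : 0 < r) (h : T * (1 - b) + b ≤ t * (1 - Real.exp (-lam)) * r) :
    0 < r - b - T * (1 - b) ∧ kMax lam t r b T =
      (1 - t * (1 - Real.exp (-lam))) * (T * (1 - b) + b) /
        (t * (1 - Real.exp (-lam)) * (r - b - T * (1 - b))) := by
  obtain ⟨hθ0, hθ1⟩ := discounted_prob_mem hlam ht0 ht1
  unfold kMax
  set θ := t * (1 - Real.exp (-lam))
  have hc : 0 < r - b - T * (1 - b) := by nlinarith
  refine ⟨hc, ?_⟩
  rw [if_pos hc, min_eq_left_iff, div_le_one (mul_pos hθ0 hc)]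
  linarith

/-- Where it is below `1`, the bound `kMax T` is the value of `k` at which `limitScore` equals
`b + T * (1 - b)`. -/
theorem le_limitScore_of_kMax_le (hr : 0 < r) (h1 : kMax lam t r b T < 1) (hk0 : 0 ≤ k)
    (hk : kMax lam t r b T ≤ k) :
    T * (1 - b) + b ≤ limitScore (t * (1 - Real.exp (-lam))) r k := by
  obtain ⟨hθ0, hθ1⟩ := discounted_prob_mem hlam ht0 ht1
  have hd := limitScore_denom_pos hlam ht0 ht1 hk0
  rcases le_total (t * (1 - Real.exp (-lam)) * r) (T * (1 - b) + b) with h | h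
  · exact absurd (kMax_eq_one hlam ht0 ht1 h) h1.ne
  obtain ⟨hc, he⟩ := kMax_eq hlam ht0 ht1 hr h
  rw [he] at hk
  unfold limitScore
  set θ := t * (1 - Real.exp (-lam))
  rw [div_le_iff₀ (mul_pos hθ0 hc)] at hk
  rw [le_div_iff₀ hd]
  linarith

theorem kMax_lt_kMax (hr : 0 < r) (hb1 : b < 1) {T₁ T₂ : ℝ} (h : T₁ < T₂)
    (h2 : kMax lam t r b T₂ < 1) : kMax lam t r b T₁ < kMax lam t r b T₂ := by
  obtain ⟨hθ0, hθ1⟩ := discounted_prob_mem hlam ht0 ht1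
  rcases le_total (t * (1 - Real.exp (-lam)) * r) (T₂ * (1 - b) + b) with h' | h'
  · exact absurd (kMax_eq_one hlam ht0 ht1 h') h2.ne
  have hlt : T₁ * (1 - b) < T₂ * (1 - b) := mul_lt_mul_of_pos_right h (by linarith)
  obtain ⟨hc2, he2⟩ := kMax_eq hlam ht0 ht1 hr h'
  obtain ⟨hc1, he1⟩ := kMax_eq hlam ht0 ht1 hr (T := T₁) (b := b) (by linarith)
  rw [he1, he2]
  set θ := t * (1 - Real.exp (-lam))
  rw [div_lt_div_iff₀ (mul_pos hθ0 hc1) (mul_pos hθ0 hc2)]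
  have : 0 < (1 - θ) * θ * r * (T₂ * (1 - b) - T₁ * (1 - b)) := by
    have := sub_pos.2 hlt
    have := sub_pos.2 hθ1
    positivity
  linarith

/-- Intermediate value theorem for the equation that defines `T^max`, to the right of any `a` at
which the left-hand side is large enough. -/
theorem exists_kMax_solution (hb1 : b < 1) (hr : 0 < r) (hr1 : r ≤ 1) {a T' : ℝ} (hT' : T' ≤ 1)
    (ha : a ≤ 1) (h : 1 - T' ≤ (1 - kMax lam t r b a) * (1 - a)) :
    ∃ T : ℝ, a ≤ T ∧ T ≤ 1 ∧ (1 - kMax lam t r b T) * (1 - T) = 1 - T' := by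
  obtain ⟨hθ0, hθ1⟩ := discounted_prob_mem hlam ht0 ht1
  have hb : 0 < 1 - b := by linarith
  set θ := t * (1 - Real.exp (-lam)) with hθ
  rcases le_total (θ * r) (a * (1 - b) + b) with h' | h'
  · rw [kMax_eq_one hlam ht0 ht1 h', sub_self, zero_mul] at h
    exact ⟨1, ha, le_rfl, by rw [sub_self, mul_zero]; linarith⟩
  -- From `c` on, `kMax` equals `1`.
  set c := (θ * r - b) / (1 - b) with hc
  have hcb : c * (1 - b) = θ * r - b := by rw [hc, div_mul_cancel₀ _ hb.ne']
  have hac : a ≤ c := by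
    rw [hc, le_div_iff₀ hb]
    linarith
  have hc1 : c ≤ 1 := by
    rw [hc, div_le_one hb]
    nlinarith
  have hcont : ContinuousOn (fun T => (1 - kMax lam t r b T) * (1 - T)) (Set.Icc a c) := by
    have hle : ∀ T ∈ Set.Icc a c, T * (1 - b) + b ≤ θ * r := fun T hT => by
      linarith [mul_le_mul_of_nonneg_right hT.2 hb.le]
    have : ContinuousOn (fun T => (1 - (1 - θ) * (T * (1 - b) + b) /
        (θ * (r - b - T * (1 - b)))) * (1 - T)) (Set.Icc a c) := by
      refine ContinuousOn.mul (continuousOn_const.sub (ContinuousOn.div (by fun_prop)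
        (by fun_prop) fun T hT => ?_)) (by fun_prop)
      exact (mul_pos hθ0 (kMax_eq hlam ht0 ht1 hr (hle T hT)).1).ne'
    refine this.congr fun T hT => ?_
    simp only
    rw [(kMax_eq hlam ht0 ht1 hr (hle T hT)).2]
  have hzero : (1 - kMax lam t r b c) * (1 - c) = 0 := by
    rw [kMax_eq_one hlam ht0 ht1 (by rw [hcb]; linarith), sub_self, zero_mul]
  obtain ⟨T, hT, hTe⟩ := intermediate_value_Icc' hac hcont
    (show 1 - T' ∈ Set.Icc _ _ by
      rw [hzero]
      exact ⟨by linarith, h⟩)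
  exact ⟨T, hT.1, hT.2.trans hc1, hTe⟩

include hbr

/-- The bound `kMin T` is the value of `k` at which `limitScore` equals `b * T`. -/
theorem kMin_le_iff (hb0 : 0 < b) (hT : T ≤ 1) (hk0 : 0 ≤ k) :
    kMin lam t r b T ≤ k ↔ T ≤ limitScore (t * (1 - Real.exp (-lam))) r k / b := by
  obtain ⟨hθ0, hθ1⟩ := discounted_prob_mem hlam ht0 ht1
  have hd := limitScore_denom_pos hlam ht0 ht1 hk0
  unfold kMin limitScore
  set θ := t * (1 - Real.exp (-lam))
  have hrb : 0 < r - b * T := by nlinarith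
  rw [div_le_iff₀ (mul_pos hθ0 hrb), le_div_iff₀ hb0, le_div_iff₀ hd]
  constructor <;> intro h <;> linarith

theorem kMin_lt_kMin (hb0 : 0 < b) {T₁ T₂ : ℝ} (h : T₁ < T₂) (h2 : T₂ ≤ 1) :
    kMin lam t r b T₁ < kMin lam t r b T₂ := by
  obtain ⟨hθ0, hθ1⟩ := discounted_prob_mem hlam ht0 ht1
  unfold kMin
  set θ := t * (1 - Real.exp (-lam))
  have hrb1 : 0 < r - b * T₁ := by nlinarith
  have hrb2 : 0 < r - b * T₂ := by nlinarith
  rw [div_lt_div_iff₀ (mul_pos hθ0 hrb1) (mul_pos hθ0 hrb2)]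
  have : 0 < b * (1 - θ) * θ * r * (T₂ - T₁) := by
    have := sub_pos.2 h
    have := sub_pos.2 hθ1
    have : 0 < r := hb0.trans hbr
    positivity
  linarith

theorem existsUnique_kMin (hb0 : 0 < b) {T' : ℝ} (hT' : T' ∈ Set.Icc (0 : ℝ) 1) :
    ∃! T : ℝ, T ∈ Set.Icc (0 : ℝ) 1 ∧ kMin lam t r b T ≤ 1 ∧
      (1 - kMin lam t r b T) * (1 - T) = 1 - T' := by
  obtain ⟨hθ0, hθ1⟩ := discounted_prob_mem hlam ht0 ht1
  have hr : 0 < r := hb0.trans hbr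
  set θ := t * (1 - Real.exp (-lam)) with hθ
  refine existsUnique_of_exists_of_unique ?_ ?_
  · -- Beyond `c` either `T > 1` or the bound exceeds `1`; at `c` the left-hand side vanishes.
    set c := min 1 (θ * r / b) with hc
    have hc0 : 0 ≤ c := le_min zero_le_one (by positivity)
    have hcont : ContinuousOn (fun T => (1 - kMin lam t r b T) * (1 - T)) (Set.Icc 0 c) := by
      unfold kMin
      rw [← hθ]
      refine ContinuousOn.mul (continuousOn_const.sub (ContinuousOn.div (by fun_prop)
        (by fun_prop) fun T hT => ?_)) (by fun_prop)
      have : T ≤ 1 := hT.2.trans (min_le_left _ _)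
      have : 0 < r - b * T := by nlinarith
      positivity
    have hzero : (1 - kMin lam t r b c) * (1 - c) = 0 := by
      rcases le_total 1 (θ * r / b) with h | h
      · rw [hc, min_eq_left h, sub_self, mul_zero]
      · have h1 : b * c = θ * r := by rw [hc, min_eq_right h, mul_div_cancel₀ _ hb0.ne']
        have h2 : θ * (r - θ * r) ≠ 0 := by
          have : 0 < r - θ * r := by nlinarith
          positivity
        have h3 : kMin lam t r b c = 1 := by
          unfold kMin
          rw [← hθ, h1, div_eq_one_iff_eq h2]
          ring
        rw [h3, sub_self, zero_mul]
    have hone : (1 - kMin lam t r b 0) * (1 - 0) = 1 := by simp [kMin]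
    obtain ⟨T, hT, hTe⟩ := intermediate_value_Icc' hc0 hcont
      (show 1 - T' ∈ Set.Icc _ _ by
        rw [hzero, hone]
        exact ⟨by linarith [hT'.2], by linarith [hT'.1]⟩)
    have hT1 : T ≤ 1 := hT.2.trans (min_le_left _ _)
    refine ⟨T, ⟨hT.1, hT1⟩, ?_, hTe⟩
    rw [kMin_le_iff hlam ht0 ht1 hbr hb0 hT1 zero_le_one]
    refine hT.2.trans ((min_le_right _ _).trans_eq ?_)
    simp [limitScore, ← hθ]
  · have key : ∀ T₁ T₂ : ℝ, T₂ ≤ 1 → kMin lam t r b T₂ ≤ 1 → T₁ < T₂ →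
        (1 - kMin lam t r b T₂) * (1 - T₂) < (1 - kMin lam t r b T₁) * (1 - T₁) := by
      intro T₁ T₂ h1 h2 h3
      have h4 := kMin_lt_kMin hlam ht0 ht1 hbr hb0 h3 h1
      exact mul_lt_mul'' (by linarith) (by linarith) (by linarith) (by linarith)
    rintro T₁ T₂ ⟨⟨-, h1⟩, h2, h3⟩ ⟨⟨-, h4⟩, h5, h6⟩
    rcases lt_trichotomy T₁ T₂ with h | h | h
    · exact absurd (h3.trans h6.symm) (key T₁ T₂ h4 h5 h).ne'
    · exact h
    · exact absurd (h3.trans h6.symm) (key T₂ T₁ h1 h2 h).ne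

theorem existsUnique_kMax (hb0 : 0 < b) (hr1 : r ≤ 1) {T' : ℝ}
    (hT' : T' ∈ Set.Icc (0 : ℝ) 1) :
    (∃ T : ℝ, T ≤ 1 ∧ (1 - kMax lam t r b T) * (1 - T) = 1 - T') ∧
      (T' < 1 → ∃! T : ℝ, (1 - kMax lam t r b T) * (1 - T) = 1 - T') := by
  obtain ⟨hθ0, hθ1⟩ := discounted_prob_mem hlam ht0 ht1
  have hr : 0 < r := hb0.trans hbr
  have hb : 0 < 1 - b := by linarith
  have hex : ∃ T : ℝ, T ≤ 1 ∧ (1 - kMax lam t r b T) * (1 - T) = 1 - T' := by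
    -- At `-b / (1 - b)` the bound `kMax` vanishes.
    have ha : -b / (1 - b) * (1 - b) + b = 0 := by
      rw [div_mul_cancel₀ _ hb.ne']
      ring
    have ha0 : -b / (1 - b) ≤ 0 := div_nonpos_of_nonpos_of_nonneg (by linarith) hb.le
    have hk := (kMax_eq hlam ht0 ht1 hr (T := -b / (1 - b)) (by rw [ha]; positivity)).2
    rw [ha, mul_zero, zero_div] at hk
    obtain ⟨T, -, h1, h2⟩ := exists_kMax_solution hlam ht0 ht1 (sub_pos.1 hb) hr hr1 hT'.2
      (a := -b / (1 - b)) (by linarith) (by rw [hk]; linarith [hT'.1])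
    exact ⟨T, h1, h2⟩
  refine ⟨hex, fun hlt => existsUnique_of_exists_of_unique (hex.imp fun T hT => hT.2) ?_⟩
  have hT1 : ∀ T : ℝ, (1 - kMax lam t r b T) * (1 - T) = 1 - T' →
      kMax lam t r b T < 1 ∧ T < 1 := by
    intro T hT
    have h1 : 0 < (1 - kMax lam t r b T) * (1 - T) := by rw [hT]; linarith
    have h2 : 0 ≤ 1 - kMax lam t r b T := sub_nonneg.2 kMax_le_one
    have h3 := pos_of_mul_pos_right h1 h2
    have h4 := pos_of_mul_pos_left h1 h3.le
    exact ⟨by linarith, by linarith⟩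
  have key : ∀ T₁ T₂ : ℝ, T₂ < 1 → kMax lam t r b T₂ < 1 → T₁ < T₂ →
      (1 - kMax lam t r b T₂) * (1 - T₂) < (1 - kMax lam t r b T₁) * (1 - T₁) := by
    intro T₁ T₂ h1 h2 h3
    have h4 := kMax_lt_kMax hlam ht0 ht1 hr (by linarith) h3 h2
    exact mul_lt_mul'' (by linarith) (by linarith) (by linarith) (by linarith)
  intro T₁ T₂ h1 h2
  rcases lt_trichotomy T₁ T₂ with h | h | h
  · exact absurd (h1.trans h2.symm) (key T₁ T₂ (hT1 T₂ h2).2 (hT1 T₂ h2).1 h).ne'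
  · exact h
  · exact absurd (h1.trans h2.symm) (key T₂ T₁ (hT1 T₁ h1).2 (hT1 T₁ h1).1 h).ne

end Bounds

end TrustModel

/-! ### Limits of the satisfied proportions -/

open TrustModel

theorem proposition3 (lam t r b : ℝ) (hlam : 0 < lam) (ht0 : 0 < t) (ht1 : t ≤ 1)
    (hr1 : r ≤ 1) (hb0 : 0 < b) (hbr : b < r)
    (k : ℝ) (m : ℕ → ℕ) (hm : ∀ N, m N ≤ N)
    (hk : Filter.Tendsto (fun N : ℕ => (m N : ℝ) / (N : ℝ)) Filter.atTop (nhds k)) :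
    -- a proportion `T` of the non-raters: necessary condition
    (∀ T ∈ Set.Icc (0 : ℝ) 1, (∀ᶠ N in Filter.atTop, m N < N) →
      T ≤ Filter.limsup
        (fun N => TrustModel.nonRaterSatisfaction (1 / 2) lam t r b N (m N)) Filter.atTop →
      TrustModel.kMin lam t r b T ≤ k) ∧
    -- a proportion `T` of the non-raters: sufficient condition
    (∀ α ∈ Set.Ico (1 / 2 : ℝ) 1, ∀ T ∈ Set.Icc (0 : ℝ) 1,
      TrustModel.kMax lam t r b T ≤ k →
      (TrustModel.kMax lam t r b T = 1 → ∀ᶠ N in Filter.atTop, m N = N) →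
      T ≤ Filter.liminf
        (fun N => TrustModel.nonRaterSatisfaction α lam t r b N (m N)) Filter.atTop) ∧
    -- a proportion `T'` of the whole community: necessary condition
    (∀ T' ∈ Set.Icc (0 : ℝ) 1,
      (∃! T : ℝ, T ∈ Set.Icc (0 : ℝ) 1 ∧ TrustModel.kMin lam t r b T ≤ 1 ∧
        (1 - TrustModel.kMin lam t r b T) * (1 - T) = 1 - T') ∧
      ∀ T ∈ Set.Icc (0 : ℝ) 1, TrustModel.kMin lam t r b T ≤ 1 →
        (1 - TrustModel.kMin lam t r b T) * (1 - T) = 1 - T' →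
        T' ≤ Filter.limsup
          (fun N => TrustModel.communitySatisfaction (1 / 2) lam t r b N (m N)) Filter.atTop →
        TrustModel.kMin lam t r b T ≤ k) ∧
    -- a proportion `T'` of the whole community: sufficient condition
    (∀ T' ∈ Set.Icc (0 : ℝ) 1,
      (∃ T : ℝ, T ≤ 1 ∧ (1 - TrustModel.kMax lam t r b T) * (1 - T) = 1 - T') ∧
      (T' < 1 → ∃! T : ℝ, (1 - TrustModel.kMax lam t r b T) * (1 - T) = 1 - T') ∧
      (TrustModel.kMax lam t r b 0 ≤ T' →
        ∃ T ∈ Set.Icc (0 : ℝ) 1, (1 - TrustModel.kMax lam t r b T) * (1 - T) = 1 - T') ∧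
      ∀ α ∈ Set.Ico (1 / 2 : ℝ) 1, ∀ T : ℝ,
        (1 - TrustModel.kMax lam t r b T) * (1 - T) = 1 - T' →
        TrustModel.kMax lam t r b T ≤ k →
        T' ≤ Filter.liminf
          (fun N => TrustModel.communitySatisfaction α lam t r b N (m N)) Filter.atTop) := by
  have hr : 0 < r := hb0.trans hbr
  have hb : 0 < 1 - b := by linarith
  obtain ⟨hk0, hk1⟩ := proportion_mem_Icc hm hk
  have hmN : ∀ N : ℕ, (0 : ℝ) ≤ (N : ℝ) - m N := fun N => sub_nonneg.2 (by exact_mod_cast hm N)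
  have hP : ∀ α N, nonRaterSatisfaction α lam t r b N (m N) ∈ Set.Icc (0 : ℝ) 1 :=
    fun α N => nonRaterSatisfaction_mem_Icc α t r b hlam (hm N)
  have hC_eq : ∀ α, 1 / 2 ≤ α → α < 1 → ∀ N, communitySatisfaction α lam t r b N (m N) =
      1 - (N : ℝ)⁻¹ * expectedUnsatisfied α lam t r b N (m N) := fun α h1 h2 N =>
    communitySatisfaction_eq (by linarith) h2 ht0 ht1 hbr lam (hm N)
  have hC : ∀ α, 1 / 2 ≤ α → α < 1 → ∀ N,
      communitySatisfaction α lam t r b N (m N) ∈ Set.Icc (0 : ℝ) 1 := by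
    intro α h1 h2 N
    obtain ⟨h3, h4⟩ := expectedUnsatisfied_mem_Icc α t r b hlam (hm N)
    rw [hC_eq α h1 h2, ← div_eq_inv_mul]
    have hN : expectedUnsatisfied α lam t r b N (m N) ≤ N :=
      h4.trans (sub_le_self _ (Nat.cast_nonneg _))
    exact ⟨sub_nonneg.2 (div_le_one_of_le₀ hN (Nat.cast_nonneg _)),
      sub_le_self _ (div_nonneg h3 (Nat.cast_nonneg _))⟩
  have hfrac : ∀ x : ℝ, Filter.Tendsto (fun N : ℕ => 1 - (1 - (m N : ℝ) / N) * x) Filter.atTop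
      (nhds (1 - (1 - k) * x)) := fun x => ((hk.const_sub 1).mul_const x).const_sub 1
  have hsplit : ∀ x : ℝ, ∀ N : ℕ, 0 < N →
      1 - (1 - (m N : ℝ) / N) * x = 1 - (N : ℝ)⁻¹ * (((N : ℝ) - m N) * x) := by
    intro x N hN
    have : (N : ℝ) ≠ 0 := by exact_mod_cast hN.ne'
    field_simp
  set z := limitScore (t * (1 - Real.exp (-lam))) r k with hz
  -- If `C` is at least `1 - (1 - m / N) * x` for a suitable `x`, it is at least `c` in the limit.
  have hC_liminf : ∀ α, 1 / 2 ≤ α → α < 1 → ∀ c x : ℝ, c < 1 - (1 - k) * x →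
      (∀ᶠ N : ℕ in Filter.atTop, expectedUnsatisfied α lam t r b N (m N) ≤ ((N : ℝ) - m N) * x) →
      c ≤ Filter.liminf (fun N => communitySatisfaction α lam t r b N (m N)) Filter.atTop := by
    intro α h1 h2 c x hc hU
    refine le_liminf_of_mem_Icc (hC α h1 h2) ?_
    filter_upwards [hU, (hfrac x).eventually_const_lt hc, Filter.eventually_gt_atTop 0]
      with N hN1 hN2 hN3
    rw [hsplit x N hN3] at hN2
    rw [hC_eq α h1 h2]
    linarith [mul_le_mul_of_nonneg_left hN1 (inv_nonneg.2 (Nat.cast_nonneg (α := ℝ) N))]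
  refine ⟨?_, ?_, ?_, ?_⟩
  · intro T hT hlt hlim
    by_contra hcon
    rw [kMin_le_iff hlam ht0 ht1 hbr hb0 hT.2 hk0, not_le] at hcon
    obtain ⟨x, hx1, hx2⟩ := exists_between (sub_lt_sub_left hcon 1)
    have := limsup_le_of_mem_Icc (hP (1 / 2)) (c := 1 - x) (by
      filter_upwards [eventually_le_expectedUnsatisfied hlam ht0 ht1 hr hb0 hm hk hx2, hlt]
        with N hN hN'
      have hpos : (0 : ℝ) < (N : ℝ) - m N := sub_pos.2 (by exact_mod_cast hN')
      rw [nonRaterSatisfaction_eq _ _ _ _ _ (hm N)]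
      exact sub_le_sub_left ((le_inv_mul_iff₀ hpos).2 hN) 1)
    linarith
  · rintro α ⟨hα, hα1⟩ T hT hkT hone
    rcases kMax_le_one.lt_or_eq with hlt | heq
    · have hTz := le_limitScore_of_kMax_le hlam ht0 ht1 hr hlt hk0 hkT
      refine le_of_forall_lt_imp_le_of_dense fun c hc => ?_
      refine le_liminf_of_mem_Icc (hP α) ?_
      have hx : (1 - z) / (1 - b) < 1 - c := by
        rw [div_lt_iff₀ hb]
        nlinarith
      filter_upwards [eventually_expectedUnsatisfied_le hlam ht0 ht1 hr hr1 hbr hα hα1 hm hk hx]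
        with N hN
      rw [nonRaterSatisfaction_eq _ _ _ _ _ (hm N)]
      -- If everybody is a rater, `(N - m)⁻¹ = 0` and the proportion is `1`.
      rcases (hmN N).eq_or_lt with h0 | hpos
      · rw [← h0, inv_zero, zero_mul]
        linarith [hT.2]
      · linarith [(inv_mul_le_iff₀ hpos).2 hN]
    · refine le_liminf_of_mem_Icc (hP α) ?_
      filter_upwards [hone heq] with N hN
      rw [nonRaterSatisfaction_eq _ _ _ _ _ (hm N), hN, sub_self, inv_zero, zero_mul, sub_zero]
      exact hT.2
  · intro T' hT'
    refine ⟨existsUnique_kMin hlam ht0 ht1 hbr hb0 hT', fun T hT hkT hTT' hlim => ?_⟩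
    by_contra hcon
    have hkk := not_le.1 hcon
    rw [kMin_le_iff hlam ht0 ht1 hbr hb0 hT.2 hk0, not_le] at hcon
    obtain ⟨x, hx1, hx2⟩ := exists_between (sub_lt_sub_left hcon 1)
    have hstrict : 1 - (1 - k) * x < T' := by
      have := mul_lt_mul'' (sub_lt_sub_left hkk 1) hx1 (sub_nonneg.2 hkT) (sub_nonneg.2 hT.2)
      linarith
    obtain ⟨c, hc1, hc2⟩ := exists_between hstrict
    have := limsup_le_of_mem_Icc (hC (1 / 2) le_rfl (by norm_num)) (c := c) (by
      filter_upwards [eventually_le_expectedUnsatisfied hlam ht0 ht1 hr hb0 hm hk hx2,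
        (hfrac x).eventually_lt_const hc1, Filter.eventually_gt_atTop 0] with N hN1 hN2 hN3
      rw [hsplit x N hN3] at hN2
      rw [hC_eq _ le_rfl (by norm_num)]
      linarith [mul_le_mul_of_nonneg_left hN1 (inv_nonneg.2 (Nat.cast_nonneg (α := ℝ) N))])
    linarith
  · intro T' hT'
    obtain ⟨hex, huniq⟩ := existsUnique_kMax hlam ht0 ht1 hbr hb0 hr1 hT'
    refine ⟨hex, huniq, fun h0 => ?_, ?_⟩
    · obtain ⟨T, h1, h2, h3⟩ := exists_kMax_solution hlam ht0 ht1 (sub_pos.1 hb) hr hr1 hT'.2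
        zero_le_one (by linarith)
      exact ⟨T, ⟨h1, h2⟩, h3⟩
    · rintro α ⟨hα, hα1⟩ T hTT' hkT
      refine le_of_forall_lt_imp_le_of_dense fun c hc => ?_
      rcases kMax_le_one.lt_or_eq with hlt | heq
      · have hTz := le_limitScore_of_kMax_le hlam ht0 ht1 hr hlt hk0 hkT
        have hle : (1 - z) / (1 - b) ≤ 1 - T := by
          rw [div_le_iff₀ hb]
          linarith
        have hTnn : 0 ≤ 1 - T := by
          refine nonneg_of_mul_nonneg_right ?_ (sub_pos.2 hlt)
          rw [hTT']
          linarith [hT'.2]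
        have hmul : (1 - k) * (1 - T) ≤ 1 - T' := by
          rw [← hTT']
          exact mul_le_mul_of_nonneg_right (sub_le_sub_left hkT 1) hTnn
        refine hC_liminf α hα hα1 c (1 - T + (T' - c) / 2) ?_
          (eventually_expectedUnsatisfied_le hlam ht0 ht1 hr hr1 hbr hα hα1 hm hk (by linarith))
        nlinarith [mul_nonneg hk0 (sub_pos.2 hc).le]
      · -- Almost everybody is a rater, and raters are satisfied.
        have hk' : k = 1 := le_antisymm hk1 (heq ▸ hkT)
        refine hC_liminf α hα hα1 c 1 (by rw [hk']; linarith [hT'.2])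
          (Filter.Eventually.of_forall fun N => ?_)
        rw [mul_one]
        exact (expectedUnsatisfied_mem_Icc α t r b hlam (hm N)).2
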